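/- **Programs.** Fix types $\tau$ with value sets $\mathcal V_\tau\ni 0$; typed local variables $\mathcal X$ (among them $\mathsf{self}$, holding the id of the current thread; the main thread has id $0$), typed globals $\mathcal G$, mutexes $\mathsf M$, program points $\mathcal N$, and expressions and conditions over the locals. A program is a control-flow graph $\mathcal E\subseteq\mathcal N\times\mathcal Act\times\mathcal N$ with start point $u_0$ and actions $\mathsf{lock}(a)$, $\mathsf{unlock}(a)$, $x{=}g$, $g{=}x$, $x{=}e$, $x{=}?$, $?c$ (guard), $x{=}\mathsf{create}(u_1)$, $\mathsf{return}\,x$, $x{=}\mathsf{join}(x')$, together with a policy saying, for each trace and create edge, from which set the id of the created thread is drawn. For each global $g$ there is a mutex $m_g$ such that every access to $g$ is immediately preceded by $\mathsf{lock}(m_g)$ and immediately followed by $\mathsf{unlock}(m_g)$ (and is not the first action of a thread). Threads only release mutexes that they hold. **Local traces.** A node $(j,u,\sigma)$ is the $j$-th configuration of the thread $\sigma\,\mathsf{self}$, with $u\in\mathcal N$ and $\sigma$ a valuation of $\mathcal X$. A local trace $t$ is a finite set of nodes and action-labelled edges consisting of one raw trace (a path of configurations linked by control-flow edges and the corresponding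 local state changes, along which $\mathsf{self}$ is constant) per occurring thread id, with create, join and locking orders $\to_c,\to_j,(\to_a)_{a\in\mathsf M}$ such that: (i) the reflexive-transitive closure $\le$ of program order and these orders is a partial order whose least node is $\mathbf 0=(0,u_0,\sigma_0)$, $\sigma_0\,\mathsf{self}=0$, and which has a unique maximal node, the sink $(\_,u,\sigma)$, where $\mathsf{loc}\,t=u$; (ii) each first node of a thread other than $\mathbf 0$ has exactly one $\to_c$-predecessor, a node at a program point with an outgoing edge creating a thread at that start point; if the predecessor has a successor in its own thread, that step is this create action $x{=}\mathsf{create}(u_1)$, and it stores the new id in $x$; each node creates at most one thread; the new thread starts in the creator's local state with $\mathsf{self}$ set to the new id; ids handed out at distinct nodes are distinct and $\neq0$; (iii) each join node (target of a join edge) has exactly one $\to_j$-predecessor, a return node; each return node has at most one $\to_j$-successor; for $x{=}\mathsf{join}(x')$, $x'$ holds the id of the returning thread and $x$ receives the returned value; (iv) each $\mathsf{lock}(a)$ node has exactly one $\to_a$-predecessor, an $\mathsf{unlock}(a)$ node or $\mathbf 0$; these have at most one $\to_a$-successor each; (v) $x{=}g$ yields the value of the last write to $g$ that is $\le$ the source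 of the read, or $0$ if there is none. $\mathsf{init}$ is the set of traces with the single node $(0,u_0,\sigma_0)$, $\sigma_0\,\mathsf{self}=0$. For $e=(u,\mathsf{act},u')\in\mathcal E$, $[\![e]\!](t)$ is the set of local traces extending $t$ (with $\mathsf{loc}\,t=u$) by this edge at the sink; for lock and join, $[\![e]\!](t_0,t_1)$ is the set of local traces consisting of $t_0\cup t_1$, this edge at the sink of $t_0$, and $\to_a$ resp. $\to_j$ from the sink of $t_1$ to the new sink; $\mathsf{new}\,u\,u_1\,t$ is the set of local traces adding to $t$ (with $\mathsf{loc}\,t=u$) a $\to_c$-edge from its sink to a new sink, the first node, at $u_1$, of a new thread. Both are extended to sets elementwise. $\mathcal T$ is the set of traces generated from $\mathsf{init}$ by these operations. For a trace $t$ and variable $x$, $t(x)$ is the value of the local $x$ at the sink, resp. the last value of the global $x$ in $t$ ($0$ if never written); $\mathsf{last}\,t$ is the last action of the ego thread (the thread of the sink), and $\mathcal T_S$ is the set of $t\in\mathcal T$ in which the ego thread holds exactly the mutexes $S$ at the sink. **Collecting semantics.** $\eta$ is the least assignment of sets of traces to unknowns $[u],[a],[i]$ such that $\mathsf{init}\subseteq\eta[u_0]$,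 $\mathsf{init}\subseteq\eta[a]$ for all $a$, and for each $e=(u,\mathsf{act},u')\in\mathcal E$: $\eta[u']\supseteq[\![e]\!](\eta[u],\eta[a])$ for $\mathsf{act}=\mathsf{lock}(a)$; $\eta[u']\supseteq[\![e]\!](\eta[u],\bigcup\{\eta[t(x')]\mid t\in\eta[u]\})$ for $x{=}\mathsf{join}(x')$; and $\eta[u']\supseteq[\![e]\!](\eta[u])$ otherwise; in addition $\eta[a]\supseteq[\![e]\!](\eta[u])$ for $\mathsf{unlock}(a)$, $\eta[u_1]\supseteq\mathsf{new}\,u\,u_1\,(\eta[u])$ for $x{=}\mathsf{create}(u_1)$, and $\eta[i]\supseteq[\![e]\!](\{t\in\eta[u]\mid t(\mathsf{self})=i\})$ for $\mathsf{return}\,x$ and every thread id $i$. **Domains.** Let $\mathcal V^\sharp_\tau$ be complete lattices with monotone $\gamma_{\mathcal V^\sharp}:\mathcal V^\sharp_\tau\to2^{\mathcal V_\tau}$, $\gamma\bot=\emptyset$, $\gamma\top=\mathcal V_\tau$, $\gamma a\cap\gamma b\subseteq\gamma(a\sqcap b)$. Let $\mathcal Vars=\mathcal X\cup\mathcal G\cup\{\mathsf{ret}\}$,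 and let $\mathcal Vars\to_\bot\mathcal V^\sharp$ be the type-consistent maps to non-$\bot$ values plus a least element $\bot$ (read as mapping every variable to $\bot$). A relational domain is a complete lattice $\mathcal R$ with operations $[\![x\leftarrow e]\!]^\sharp$ ($e$ a variable, the constant $0$ or a local expression), restriction $r|_Y$, $[\![?c]\!]^\sharp$, $\mathsf{lift}:(\mathcal Vars\to_\bot\mathcal V^\sharp)\to\mathcal R$, $\mathsf{unlift}$ in the reverse direction, and monotone $\gamma_{\mathcal R}:\mathcal R\to2^{\mathcal Vars\to\mathcal V}$, such that $\mathsf{lift}\bot=\bot$, $\mathsf{unlift}\bot=\bot$, $\mathsf{unlift}\circ\mathsf{lift}\sqsupseteq\mathsf{id}$; for $r\ne\bot$: $r|_{\mathcal Vars}=r$, $r|_\emptyset=\top$, $r|_{Y_1}\sqsupseteq r|_{Y_2}$ if $Y_1\subseteq Y_2$, $(r|_{Y_1})|_{Y_2}=r|_{Y_1\cap Y_2}$, $\mathsf{unlift}(r|_Y)\,x=\top$ for $x\notin Y$ and $=\mathsf{unlift}\,r\,x$ for $x\in Y$; and $\gamma_{\mathcal R}\bot=\emptyset$, $\gamma_{\mathcal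 R}r\cap\gamma_{\mathcal R}s\subseteq\gamma_{\mathcal R}(r\sqcap s)$; for $\sigma\in\gamma_{\mathcal R}r$: $\sigma\oplus\{x\mapsto[\![e]\!]\sigma\}\in\gamma_{\mathcal R}([\![x\leftarrow e]\!]^\sharp r)$, $\sigma'\in\gamma_{\mathcal R}(r|_Y)$ for all $\sigma'$ agreeing with $\sigma$ on $Y$, $\sigma\in\gamma_{\mathcal R}([\![?c]\!]^\sharp r)$ if $c$ holds in $\sigma$, and $\sigma\,x\in\gamma_{\mathcal V^\sharp}(\mathsf{unlift}\,r\,x)$; and $\{\sigma\mid\forall x:\sigma\,x\in\gamma_{\mathcal V^\sharp}(s\,x)\}\subseteq\gamma_{\mathcal R}(\mathsf{lift}\,s)$. Put $[\![x\leftarrow^\sharp v]\!]r=r|_{\mathcal Vars\setminus\{x\}}\sqcap\mathsf{lift}(\top\oplus\{x\mapsto v\})$, where the argument of $\mathsf{lift}$ is $\bot$ if $v=\bot$. **Analysis.** Let $\mathcal M[g]\subseteq\mathsf M$ be a set of mutexes that are all held whenever $g$ is written (in every $t\in\eta[u]$, for every edge $(u,g{=}x,u')$); $\mathcal G[a]=\{g\mid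 a\in\mathcal M[g]\}$; and for each $a$ let $\mathcal Q_a$ be a non-empty finite set of finite subsets of $\mathcal G[a]$. Let $i_0\in\mathcal V^\sharp_{\mathcal I}$ (the abstract values for thread ids) with $0\in\gamma_{\mathcal V^\sharp}i_0$, and $\nu^\sharp:\mathcal N\to\mathcal N\to\mathcal R\to\mathcal V^\sharp_{\mathcal I}$ with $t'(\mathsf{self})\in\gamma_{\mathcal V^\sharp}(\nu^\sharp\,u\,u_1\,r)$ whenever $t\in\gamma_{u,S}(r)$ (defined below) and $t'\in\mathsf{new}\,u\,u_1\,t$. Unknowns $[u,S]$ ($S\subseteq\mathsf M$), $[a,Q]$ ($Q\in\mathcal Q_a$), $[i^\sharp]$ ($i^\sharp\in\mathcal V^\sharp_{\mathcal I}$) take values in $\mathcal R$. A solution $\eta^\sharp$ satisfies $\eta^\sharp[u_0,\emptyset]\sqsupseteq[\![\mathsf{self}\leftarrow^\sharp i_0]\!]\top$, $\eta^\sharp[a,Q]\sqsupseteq[\![\{g\leftarrow0\mid g\in Q\}]\!]^\sharp\top$ (assigned one by one, in any fixed order), and for each edge $(u,\mathsf{act},u')$ and each $S$ with $r=\eta^\sharp[u,S]\neq\bot$: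 - $\mathsf{lock}(a)$: $\eta^\sharp[u',S\cup\{a\}]\sqsupseteq r\sqcap\bigsqcap_{Q\in\mathcal Q_a}\eta^\sharp[a,Q]$; - $\mathsf{unlock}(a)$: $\eta^\sharp[u',S\setminus\{a\}]\sqsupseteq r|_{\mathcal X\cup\bigcup\{\mathcal G[a']\mid a'\in S\setminus\{a\}\}}$ and $\eta^\sharp[a,Q]\sqsupseteq r|_Q$ for $Q\in\mathcal Q_a$; - $x{=}g$, $g{=}x$, $x{=}e$, $?c$, $x{=}?$: $\eta^\sharp[u',S]\sqsupseteq[\![x\leftarrow g]\!]^\sharp r$, $[\![g\leftarrow x]\!]^\sharp r$, $[\![x\leftarrow e]\!]^\sharp r$, $[\![?c]\!]^\sharp r$, $r|_{\mathcal Vars\setminus\{x\}}$, respectively; - $x{=}\mathsf{create}(u_1)$: with $i=\nu^\sharp\,u\,u_1\,r$, $\eta^\sharp[u',S]\sqsupseteq[\![x\leftarrow^\sharp i]\!]r$ and $\eta^\sharp[u_1,\emptyset]\sqsupseteq([\![\mathsf{self}\leftarrow^\sharp i]\!]r)|_{\mathcal X}$; - $\mathsf{return}\,x$: $\eta^\sharp[u',S]\sqsupseteq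 r$ and $\eta^\sharp[\mathsf{unlift}\,r\,\mathsf{self}]\sqsupseteq([\![\mathsf{ret}\leftarrow x]\!]^\sharp r)|_{\{\mathsf{ret}\}}$; - $x{=}\mathsf{join}(x')$: $\eta^\sharp[u',S]\sqsupseteq[\![x\leftarrow^\sharp v]\!]r$ with $v=\bigsqcup\{\mathsf{unlift}(\eta^\sharp[i'])\,\mathsf{ret}\mid\mathsf{unlift}\,r\,x'\sqcap i'\neq\bot\}$. **Concretizations.** With $\beta\,t=\{x\mapsto t(x)\mid x\in\mathcal X\cup\mathcal G\}$: $\gamma_{u,S}(r)=\{t\in\mathcal T_S\mid\mathsf{loc}\,t=u,\ \exists v:\beta t\cup\{\mathsf{ret}\mapsto v\}\in\gamma_{\mathcal R}r\}$; $\gamma_i(r)=\{t\in\mathcal T\mid\exists x:\mathsf{last}\,t=(\mathsf{return}\,x),\ \beta t\cup\{\mathsf{ret}\mapsto t(x)\}\in\gamma_{\mathcal R}r\}$; $\gamma_a(r)=\{t\in\mathcal T\mid\mathsf{last}\,t=\mathsf{unlock}(a)\text{ or }t\in\mathsf{init},\ \exists v:\beta t\cup\{\mathsf{ret}\mapsto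 v\}\in\gamma_{\mathcal R}r\}$. **Theorem.** Every solution $\eta^\sharp$ of the constraint system of the analysis is sound with respect to the collecting local trace semantics $\eta$: for all $u\in\mathcal N$, $S\subseteq\mathsf M$, all thread ids $i$, all $a\in\mathsf M$ and $Q\in\mathcal Q_a$, $$\eta[u]\cap\mathcal T_S\subseteq\gamma_{u,S}(\eta^\sharp[u,S]),\qquad \eta[i]\subseteq\bigcup\{\gamma_i(\eta^\sharp[i^\sharp])\mid i\in\gamma_{\mathcal V^\sharp}i^\sharp\},\qquad \eta[a]\subseteq\gamma_a(\eta^\sharp[a,Q]).$$ -/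

import Mathlib

universe u v w

namespace LocalTraces

noncomputable section

open scoped Classical

/-! ### Programs -/

/-- The typed vocabulary of a program: types `Ty` and their values `Val` (each with a value `0`),
the type `tid` of thread ids (the main thread has id `0`), the type `rty` of values returned by
threads, local variables `X` and global variables `G` of each type, the local variable `self`,
mutexes `M`, program points `N`, and expressions and conditions over the local variables. -/
structure Lang where
  Ty : Type u
  Val : Ty → Type u
  zero : ∀ τ, Val τ
  tid : Ty
  rty : Ty
  X : Ty → Type u
  G : Ty → Type u
  self : X tid
  M : Type u
  N : Type u
  Expr : Ty → Type u
  eval : ∀ {τ : Ty}, Expr τ → (∀ x : (Σ τ, X τ), Val x.1) → Val τ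
  Cond : Type u
  holds : Cond → (∀ x : (Σ τ, X τ), Val x.1) → Prop

/-- Type-consistent assignments of values to the local variables. -/
abbrev LState (L : Lang.{u}) : Type u := ∀ x : (Σ τ, L.X τ), L.Val x.1

/-- Global variables together with their type. -/
abbrev Glob (L : Lang.{u}) : Type u := Σ τ, L.G τ

/-- Actions. `havoc x` is the non-deterministic assignment `x = ?`. -/
inductive Act (L : Lang.{u}) : Type u
  | lock (a : L.M)
  | unlock (a : L.M)
  | read {τ : L.Ty} (x : L.X τ) (g : L.G τ)
  | write {τ : L.Ty} (g : L.G τ) (x : L.X τ)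
  | assign {τ : L.Ty} (x : L.X τ) (e : L.Expr τ)
  | havoc {τ : L.Ty} (x : L.X τ)
  | guard (c : L.Cond)
  | create (x : L.X L.tid) (u₁ : L.N)
  | ret (x : L.X L.rty)
  | join (x : L.X L.rty) (x' : L.X L.tid)

/-- The action reads or writes the global `g`. -/
inductive Act.Accesses {L : Lang.{u}} : Act L → Glob L → Prop
  | read {τ : L.Ty} (x : L.X τ) (g : L.G τ) : Act.Accesses (.read x g) ⟨τ, g⟩
  | write {τ : L.Ty} (g : L.G τ) (x : L.X τ) : Act.Accesses (.write g x) ⟨τ, g⟩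

/-- Transitions of a single thread between local states; any value may be read from a global,
obtained as a new thread id, or obtained from a join. -/
def Act.Step {L : Lang.{u}} : Act L → LState L → LState L → Prop
  | .lock _, σ, σ' => σ' = σ
  | .unlock _, σ, σ' => σ' = σ
  | .read (τ := τ) x _, σ, σ' => ∃ v : L.Val τ, σ' = Function.update σ ⟨τ, x⟩ v
  | .write _ _, σ, σ' => σ' = σ
  | .assign (τ := τ) x e, σ, σ' => σ' = Function.update σ ⟨τ, x⟩ (L.eval e σ)
  | .havoc (τ := τ) x, σ, σ' => ∃ v : L.Val τ, σ' = Function.update σ ⟨τ, x⟩ v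
  | .guard c, σ, σ' => L.holds c σ ∧ σ' = σ
  | .create x _, σ, σ' => ∃ i : L.Val L.tid, σ' = Function.update σ ⟨L.tid, x⟩ i
  | .ret _, σ, σ' => σ' = σ
  | .join x _, σ, σ' => ∃ v : L.Val L.rty, σ' = Function.update σ ⟨L.rty, x⟩ v

/-- Nodes `(j, u, σ)` of a trace: the `j`-th configuration `(u, σ)` of a thread. -/
@[ext] structure Node (L : Lang.{u}) where
  idx : ℕ
  pt : L.N
  σ : LState L

/-- The id of the thread a node belongs to. -/
def Node.tid {L : Lang.{u}} (n : Node L) : L.Val L.tid := n.σ ⟨L.tid, L.self⟩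

/-- The node is the first one of the main thread. -/
def Node.IsZero {L : Lang.{u}} (n : Node L) : Prop := n.idx = 0 ∧ n.tid = L.zero L.tid

/-- Data of a trace: nodes, program edges, create order, join order, locking orders, and the sink
(for a local trace: its maximal node). -/
@[ext] structure Trace (L : Lang.{u}) where
  nodes : Set (Node L)
  edges : Set (Node L × Act L × Node L)
  creates : Node L → Node L → Prop
  joins : Node L → Node L → Prop
  locks : L.M → Node L → Node L → Prop
  sink : Node L

/-- A program: a control-flow graph, the start point of the main thread, for each global `g` the
mutex `m_g`, and a policy for choosing ids: `alloc t u u₁` is the set of thread ids from which the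
id of a thread started at `u₁` is drawn when it is created at program point `u` by the ego thread of
`t` (`IsLocal` ensures that only fresh ids are ever used). -/
structure Prog (L : Lang.{u}) where
  edge : L.N → Act L → L.N → Prop
  start : L.N
  mg : Glob L → L.M
  alloc : Trace L → L.N → L.N → Set (L.Val L.tid)

/-- Accesses to a global `g` are atomic: `m_g` is acquired immediately before every access to `g`
and released immediately after it. -/
structure Prog.AtomicAccess {L : Lang.{u}} (P : Prog L) : Prop where
  lock_before : ∀ {p act q g}, P.edge p act q → act.Accesses g →
    ∀ {o act'}, P.edge o act' p → act' = .lock (P.mg g)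
  ne_start : ∀ {p act q g}, P.edge p act q → act.Accesses g → p ≠ P.start
  ne_created : ∀ {p act q g}, P.edge p act q → act.Accesses g →
    ∀ {o x r}, ¬ P.edge o (.create x p) r
  unlock_after : ∀ {p act q g}, P.edge p act q → act.Accesses g →
    ∀ {act' r}, P.edge q act' r → act' = .unlock (P.mg g)

/-! ### Local traces -/

namespace Trace

variable {L : Lang.{u}} (t : Trace L)

/-- The union of program order, create order, join order and locking orders. -/
def Prec (m n : Node L) : Prop :=
  (∃ act, (m, act, n) ∈ t.edges) ∨ t.creates m n ∨ t.joins m n ∨ ∃ a, t.locks a m n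

/-- The causality order. -/
def Le : Node L → Node L → Prop := Relation.ReflTransGen t.Prec

/-- `n` has an incoming edge labelled `lock(a)`. -/
def IsLock (a : L.M) (n : Node L) : Prop := ∃ m, (m, .lock a, n) ∈ t.edges

/-- `n` has an incoming edge labelled `unlock(a)`. -/
def IsUnlock (a : L.M) (n : Node L) : Prop := ∃ m, (m, .unlock a, n) ∈ t.edges

/-- `n` has an incoming edge labelled by a join. -/
def IsJoin (n : Node L) : Prop := ∃ m x x', (m, .join x x', n) ∈ t.edges

/-- `n` has an incoming edge labelled by a return. -/
def IsReturn (n : Node L) : Prop := ∃ m x, (m, .ret x, n) ∈ t.edges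

/-- The thread id `i` is given away at node `z`: to the variable `x` by an edge `x = create(u₁)`
leaving `z`, or to a thread created at `z`. -/
def Allocates (z : Node L) (i : L.Val L.tid) : Prop :=
  (∃ x u₁ z', (z, .create x u₁, z') ∈ t.edges ∧ z'.σ ⟨L.tid, x⟩ = i) ∨
    ∃ s, t.creates z s ∧ s.tid = i

/-- The edge `(p, g = y, q)` is the last write to `g` among those below the node `z`. -/
def IsLastWrite {τ : L.Ty} (z : Node L) (g : L.G τ) (p : Node L) (y : L.X τ) (q : Node L) : Prop :=
  (p, .write g y, q) ∈ t.edges ∧ t.Le q z ∧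
    ∀ p' y' q', (p', .write g y', q') ∈ t.edges → t.Le q' z → t.Le q' q

/-- The mutexes held at node `z`: those acquired by the thread of `z` and not released since. -/
def lockset (z : Node L) : Set L.M :=
  {a | ∃ m n, (m, .lock a, n) ∈ t.edges ∧ n.tid = z.tid ∧ n.idx ≤ z.idx ∧
    ∀ m' n', (m', .unlock a, n') ∈ t.edges → n'.tid = z.tid → n'.idx ≤ z.idx → n'.idx < n.idx}

/-- The last value of the global `g` in `t`; it is `0` if `g` has not been written. -/
def lastValue (g : Glob L) : L.Val g.1 :=
  if h : ∃ e : Node L × L.X g.1 × Node L, t.IsLastWrite t.sink g.2 e.1 e.2.1 e.2.2 then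
    h.choose.1.σ ⟨g.1, h.choose.2.1⟩
  else L.zero g.1

/-- The last action of the ego thread is `act`. -/
def Last (act : Act L) : Prop := ∃ m, (m, act, t.sink) ∈ t.edges

/-- The trace consisting of a single node. -/
def single (n : Node L) : Trace L where
  nodes := {n}
  edges := ∅
  creates := fun _ _ => False
  joins := fun _ _ => False
  locks := fun _ _ _ => False
  sink := n

/-- Union of two traces, with the sink of the first. -/
def union (t₀ t₁ : Trace L) : Trace L where
  nodes := t₀.nodes ∪ t₁.nodes
  edges := t₀.edges ∪ t₁.edges
  creates := fun m n => t₀.creates m n ∨ t₁.creates m n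
  joins := fun m n => t₀.joins m n ∨ t₁.joins m n
  locks := fun a m n => t₀.locks a m n ∨ t₁.locks a m n
  sink := t₀.sink

/-- Extension by an edge `act` from the sink to a new sink `n`. -/
def extend (act : Act L) (n : Node L) : Trace L :=
  { t with
    nodes := insert n t.nodes
    edges := insert (t.sink, act, n) t.edges
    sink := n }

/-- Extension by a new thread with start node `n`, created at the sink. -/
def spawn (n : Node L) : Trace L :=
  { t with
    nodes := insert n t.nodes
    creates := fun m m' => t.creates m m' ∨ (m = t.sink ∧ m' = n)
    sink := n }

/-- Adding `m →ₐ n`. -/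
def addLock (a : L.M) (m n : Node L) : Trace L :=
  { t with locks := fun b p q => t.locks b p q ∨ (b = a ∧ p = m ∧ q = n) }

/-- Adding `m →ⱼ n`. -/
def addJoin (m n : Node L) : Trace L :=
  { t with joins := fun p q => t.joins p q ∨ (p = m ∧ q = n) }

/-- `t` is a local trace over the control-flow graph of `P`. -/
structure IsLocal (P : Prog L) (t : Trace L) : Prop where
  -- The nodes and edges are those of one raw trace for each occurring thread id.
  finite : t.nodes.Finite
  node_unique : ∀ m ∈ t.nodes, ∀ n ∈ t.nodes, m.tid = n.tid → m.idx = n.idx → m = n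
  edge_unique : ∀ m m' act act' n, (m, act, n) ∈ t.edges → (m', act', n) ∈ t.edges →
    m = m' ∧ act = act'
  edge_exists : ∀ n ∈ t.nodes, n.idx ≠ 0 → ∃ m act, (m, act, n) ∈ t.edges
  edge_step : ∀ m act n, (m, act, n) ∈ t.edges → m ∈ t.nodes ∧ n ∈ t.nodes ∧
    n.idx = m.idx + 1 ∧ n.tid = m.tid ∧ P.edge m.pt act n.pt ∧ act.Step m.σ n.σ
  -- Causality order.
  antisymm : ∀ m n, t.Le m n → t.Le n m → m = n
  least : ∃ z ∈ t.nodes, z.IsZero ∧ z.pt = P.start ∧ ∀ n ∈ t.nodes, t.Le z n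
  -- Create order. A creating node need not have an outgoing edge yet; if it has one, this edge is
  -- the create action.
  create_mem : ∀ z s, t.creates z s → z ∈ t.nodes ∧ s ∈ t.nodes ∧ s.idx = 0 ∧ ¬ s.IsZero ∧
    ∃ x u', P.edge z.pt (.create x s.pt) u'
  create_unique : ∀ s ∈ t.nodes, s.idx = 0 → ¬ s.IsZero → ∃! z, t.creates z s
  create_inj : ∀ z s s', t.creates z s → t.creates z s' → s = s'
  create_state : ∀ z s, t.creates z s → s.σ = Function.update z.σ ⟨L.tid, L.self⟩ s.tid
  create_edge : ∀ z s act z', t.creates z s → (z, act, z') ∈ t.edges →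
    ∃ x, act = .create x s.pt ∧ z'.σ ⟨L.tid, x⟩ = s.tid
  -- Ids of created threads are fresh.
  fresh_zero : ∀ z i, t.Allocates z i → i ≠ L.zero L.tid
  fresh : ∀ z z' i, t.Allocates z i → t.Allocates z' i → z = z'
  -- Join order.
  join_mem : ∀ r n, t.joins r n → t.IsReturn r ∧ t.IsJoin n
  join_unique : ∀ n, t.IsJoin n → ∃! r, t.joins r n
  join_inj : ∀ r n n', t.joins r n → t.joins r n' → n = n'
  join_value : ∀ p x x' n q y r, (p, .join x x', n) ∈ t.edges → (q, .ret y, r) ∈ t.edges →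
    t.joins r n → p.σ ⟨L.tid, x'⟩ = q.tid ∧ n.σ ⟨L.rty, x⟩ = q.σ ⟨L.rty, y⟩
  -- Locking order.
  lock_mem : ∀ a m n, t.locks a m n →
    (t.IsUnlock a m ∨ (m ∈ t.nodes ∧ m.IsZero)) ∧ t.IsLock a n
  lock_unique : ∀ a n, t.IsLock a n → ∃! m, t.locks a m n
  lock_inj : ∀ a m n n', t.locks a m n → t.locks a m n' → n = n'
  -- The value read for a global is the last value written to it, or `0`.
  read_value : ∀ (τ : L.Ty) (z z' : Node L) (x : L.X τ) (g : L.G τ), (z, .read x g, z') ∈ t.edges →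
    (∃ p y q, t.IsLastWrite z g p y q ∧ z'.σ ⟨τ, x⟩ = p.σ ⟨τ, y⟩) ∨
    ((∀ p y q, (p, .write g y, q) ∈ t.edges → ¬ t.Le q z) ∧ z'.σ ⟨τ, x⟩ = L.zero τ)
  -- The sink is the maximal node.
  sink_mem : t.sink ∈ t.nodes
  le_sink : ∀ n ∈ t.nodes, t.Le n t.sink

end Trace

/-! ### The collecting local trace semantics -/

section Semantics

variable {L : Lang.{u}} (P : Prog L)

/-- Initial local traces. -/
def initTraces : Set (Trace L) :=
  {t | ∃ σ : LState L, σ ⟨L.tid, L.self⟩ = L.zero L.tid ∧ t = Trace.single ⟨0, P.start, σ⟩}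

/-- Effect of a unary edge `(p, act, q)` on a local trace. -/
def sem₁ (p : L.N) (act : Act L) (q : L.N) (t : Trace L) : Set (Trace L) :=
  {t' | t.sink.pt = p ∧ ∃ σ' : LState L,
    t' = t.extend act ⟨t.sink.idx + 1, q, σ'⟩ ∧ t'.IsLocal P ∧
    ∀ x u₁, act = .create x u₁ → σ' ⟨L.tid, x⟩ ∈ P.alloc t p u₁}

/-- Effect of an edge `(p, lock(a), q)`: `t₁` is incorporated. -/
def semLock (p : L.N) (a : L.M) (q : L.N) (t₀ t₁ : Trace L) : Set (Trace L) :=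
  {t' | t₀.sink.pt = p ∧ ∃ σ' : LState L,
    t' = ((t₀.union t₁).extend (.lock a) ⟨t₀.sink.idx + 1, q, σ'⟩).addLock a t₁.sink
      ⟨t₀.sink.idx + 1, q, σ'⟩ ∧ t'.IsLocal P}

/-- Effect of an edge `(p, x = join(x'), q)`: `t₁` is incorporated. -/
def semJoin (p : L.N) (x : L.X L.rty) (x' : L.X L.tid) (q : L.N) (t₀ t₁ : Trace L) :
    Set (Trace L) :=
  {t' | t₀.sink.pt = p ∧ ∃ σ' : LState L,
    t' = ((t₀.union t₁).extend (.join x x') ⟨t₀.sink.idx + 1, q, σ'⟩).addJoin t₁.sink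
      ⟨t₀.sink.idx + 1, q, σ'⟩ ∧ t'.IsLocal P}

/-- Local traces of a thread just created at `u₁` by the ego thread of `t` at `p`. -/
def newTraces (p u₁ : L.N) (t : Trace L) : Set (Trace L) :=
  {t' | t.sink.pt = p ∧ ∃ i ∈ P.alloc t p u₁,
    t' = t.spawn ⟨0, u₁, Function.update t.sink.σ ⟨L.tid, L.self⟩ i⟩ ∧ t'.IsLocal P}

/-- The set of all local traces of the program. -/
inductive Traces : Trace L → Prop
  | init {t : Trace L} : t ∈ initTraces P → Traces t
  | unary {p act q t t'} : P.edge p act q → (∀ a, act ≠ .lock a) → (∀ x x', act ≠ .join x x') →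
      Traces t → t' ∈ sem₁ P p act q t → Traces t'
  | lock {p a q t₀ t₁ t'} : P.edge p (.lock a) q → Traces t₀ → Traces t₁ →
      t' ∈ semLock P p a q t₀ t₁ → Traces t'
  | join {p x x' q t₀ t₁ t'} : P.edge p (.join x x') q → Traces t₀ → Traces t₁ →
      t' ∈ semJoin P p x x' q t₀ t₁ → Traces t'
  | create {p x u₁ q t t'} : P.edge p (.create x u₁) q → Traces t →
      t' ∈ newTraces P p u₁ t → Traces t'

/-- Unknowns `[u]`, `[a]`, `[i]` of the concrete constraint system. -/
inductive CUnknown (L : Lang.{u}) : Type u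
  | point (p : L.N)
  | mutex (a : L.M)
  | thread (i : L.Val L.tid)

/-- Right-hand side for an edge: side-effects and contribution to the left-hand side. -/
def concreteRhs (p : L.N) (act : Act L) (q : L.N) (η : CUnknown L → Set (Trace L)) :
    (CUnknown L → Set (Trace L)) × Set (Trace L) :=
  match act with
  | .lock a => (⊥, {t' | ∃ t₀ ∈ η (.point p), ∃ t₁ ∈ η (.mutex a), t' ∈ semLock P p a q t₀ t₁})
  | .unlock a =>
      let T := {t' | ∃ t ∈ η (.point p), t' ∈ sem₁ P p (.unlock a) q t}
      (Function.update ⊥ (.mutex a) T, T)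
  | .create x u₁ =>
      (Function.update ⊥ (.point u₁) {t' | ∃ t ∈ η (.point p), t' ∈ newTraces P p u₁ t},
        {t' | ∃ t ∈ η (.point p), t' ∈ sem₁ P p (.create x u₁) q t})
  | .join x x' =>
      (⊥, {t' | ∃ t₀ ∈ η (.point p),
        ∃ t₁ ∈ ⋃ t ∈ η (.point p), η (.thread (t.sink.σ ⟨L.tid, x'⟩)),
          t' ∈ semJoin P p x x' q t₀ t₁})
  | .ret x =>
      (fun y => match y with
        | .thread i =>
            {t' | ∃ t ∈ {t ∈ η (.point p) | t.sink.tid = i}, t' ∈ sem₁ P p (.ret x) q t}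
        | _ => ∅,
        {t' | ∃ t ∈ η (.point p), t' ∈ sem₁ P p (.ret x) q t})
  | act => (⊥, {t' | ∃ t ∈ η (.point p), t' ∈ sem₁ P p act q t})

/-- Solutions of the concrete constraint system. -/
structure IsConcreteSolution (η : CUnknown L → Set (Trace L)) : Prop where
  init_side : ∀ a, initTraces P ⊆ η (.mutex a)
  init : initTraces P ⊆ η (.point P.start)
  edge_side : ∀ p act q, P.edge p act q → (concreteRhs P p act q η).1 ≤ η
  edge : ∀ p act q, P.edge p act q → (concreteRhs P p act q η).2 ⊆ η (.point q)

/-- The collecting local trace semantics: the least solution of the concrete constraint system. -/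
def collecting : CUnknown L → Set (Trace L) := sInf {η | IsConcreteSolution P η}

theorem concreteRhs_mono (p : L.N) (act : Act L) (q : L.N) {η η' : CUnknown L → Set (Trace L)}
    (h : η ≤ η') : (concreteRhs P p act q η).1 ≤ (concreteRhs P p act q η').1 ∧
      (concreteRhs P p act q η).2 ⊆ (concreteRhs P p act q η').2 := by
  have hh : ∀ k t, t ∈ η k → t ∈ η' k := fun k t => @h k t
  constructor
  · cases act <;> simp only [concreteRhs] <;> intro k <;> try exact le_rfl
    · simp only [Function.update_apply]; split_ifs
      · rintro t ⟨t0, h0, h1⟩; exact ⟨t0, hh _ _ h0, h1⟩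
      · exact le_rfl
    · simp only [Function.update_apply]; split_ifs
      · rintro t ⟨t0, h0, h1⟩; exact ⟨t0, hh _ _ h0, h1⟩
      · exact le_rfl
    · cases k <;> try exact le_rfl
      rintro t ⟨t0, ⟨h0, h2⟩, h1⟩; exact ⟨t0, ⟨hh _ _ h0, h2⟩, h1⟩
  · cases act <;> simp only [concreteRhs]
    case lock => rintro t ⟨t0, h0, t1, h1, h2⟩; exact ⟨t0, hh _ _ h0, t1, hh _ _ h1, h2⟩
    case join =>
      rintro t ⟨t0, h0, t1, h1, h2⟩
      simp only [Set.mem_iUnion] at h1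
      obtain ⟨t3, h3, h4⟩ := h1
      refine ⟨t0, hh _ _ h0, t1, ?_, h2⟩
      simp only [Set.mem_iUnion]; exact ⟨t3, hh _ _ h3, hh _ _ h4⟩
    all_goals rintro t ⟨t0, h0, h1⟩; exact ⟨t0, hh _ _ h0, h1⟩

/-- `collecting` is indeed the least solution. -/
theorem collecting_isLeast : IsLeast {η | IsConcreteSolution P η} (collecting P) := by
  have lb : ∀ η ∈ {η | IsConcreteSolution P η}, collecting P ≤ η := fun η h => sInf_le h
  refine ⟨⟨?_, ?_, ?_, ?_⟩, lb⟩
  · intro a t ht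
    simp only [collecting, sInf_apply, Set.mem_iInter, Set.iInf_eq_iInter]
    intro η; exact η.2.init_side a ht
  · intro t ht
    simp only [collecting, sInf_apply, Set.mem_iInter, Set.iInf_eq_iInter]
    intro η; exact η.2.init ht
  · intro p act q e
    exact le_sInf fun η h => (concreteRhs_mono P p act q (lb η h)).1.trans (h.edge_side p act q e)
  · intro p act q e t ht
    simp only [collecting, sInf_apply, Set.mem_iInter, Set.iInf_eq_iInter]
    intro η; exact η.2.edge p act q e ((concreteRhs_mono P p act q (lb η.1 η.2)).2 ht)

/-- Threads only release mutexes which they hold. -/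
def ProperUnlocking : Prop :=
  ∀ p a q, P.edge p (.unlock a) q → ∀ t ∈ collecting P (.point p), a ∈ t.lockset t.sink

/-- All mutexes of `prot g` are held whenever `g` is written. -/
def Protects (prot : Glob L → Set L.M) : Prop :=
  ∀ (τ : L.Ty) (g : L.G τ) (x : L.X τ) p q, P.edge p (.write g x) q →
    ∀ t ∈ collecting P (.point p), prot ⟨τ, g⟩ ⊆ t.lockset t.sink

end Semantics

/-! ### Relational domains -/

/-- The variables of the analysis: locals, globals, and the dedicated variable `ret`. -/
inductive Var (L : Lang.{u}) : L.Ty → Type u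
  | loc {τ : L.Ty} (x : L.X τ) : Var L τ
  | glob {τ : L.Ty} (g : L.G τ) : Var L τ
  | ret : Var L L.rty

/-- Variables together with their type. -/
abbrev Vars (L : Lang.{u}) : Type u := Σ τ, Var L τ

/-- Type-consistent assignments of values to all variables. -/
abbrev Store (L : Lang.{u}) : Type u := ∀ y : Vars L, L.Val y.1

/-- Right-hand sides of assignments: a variable, the constant `0`, or an expression over the
local variables. -/
inductive RExpr (L : Lang.{u}) (τ : L.Ty) : Type u
  | var (y : Var L τ)
  | zero
  | expr (e : L.Expr τ)

/-- The local part of a store. -/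
def Store.locals {L : Lang.{u}} (σ : Store L) : LState L := fun x => σ ⟨x.1, .loc x.2⟩

/-- Value of a right-hand side. -/
def RExpr.eval {L : Lang.{u}} {τ : L.Ty} (σ : Store L) : RExpr L τ → L.Val τ
  | .var y => σ ⟨τ, y⟩
  | .zero => L.zero τ
  | .expr e => L.eval e σ.locals

/-- Concretization of the complete lattices `A τ` of abstract values. -/
structure ValueDomain (L : Lang.{u}) (A : L.Ty → Type v) [∀ τ, CompleteLattice (A τ)] where
  γ : ∀ {τ : L.Ty}, A τ → Set (L.Val τ)
  γ_mono : ∀ {τ : L.Ty} {a b : A τ}, a ≤ b → γ a ⊆ γ b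
  γ_bot : ∀ τ : L.Ty, γ (⊥ : A τ) = ∅
  γ_top : ∀ τ : L.Ty, γ (⊤ : A τ) = Set.univ
  γ_inf : ∀ {τ : L.Ty} (a b : A τ), γ a ∩ γ b ⊆ γ (a ⊓ b)

/-- Type-consistent assignments of non-`⊥` abstract values, with an additional least element. -/
abbrev AbsAssign (L : Lang.{u}) (A : L.Ty → Type v) [∀ τ, CompleteLattice (A τ)] :
    Type (max u v) :=
  WithBot {f : ∀ y : Vars L, A y.1 // ∀ y, f y ≠ ⊥}

section AbsAssign

variable {L : Lang.{u}} {A : L.Ty → Type v} [∀ τ, CompleteLattice (A τ)]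

/-- The abstract value of a variable; the least assignment maps every variable to `⊥`. -/
def AbsAssign.val (s : AbsAssign L A) (y : Vars L) : A y.1 :=
  WithBot.recBotCoe (C := fun _ => A y.1) ⊥ (fun f => f.1 y) s

/-- The assignment `⊤ ⊕ {y ↦ a}` (which is `⊥` if `a = ⊥`). -/
def AbsAssign.topUpdate (y : Vars L) (a : A y.1) : AbsAssign L A :=
  if h : ∀ z, Function.update (fun z : Vars L => (⊤ : A z.1)) y a z ≠ ⊥ then
    ((⟨_, h⟩ : {f : ∀ y : Vars L, A y.1 // ∀ y, f y ≠ ⊥}) : AbsAssign L A)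
  else ⊥

end AbsAssign

/-- Relational domains. The algebraic laws of restriction concern satisfiable relations only. -/
structure RelationalDomain (L : Lang.{u}) (A : L.Ty → Type v) [∀ τ, CompleteLattice (A τ)]
    (V : ValueDomain L A) (R : Type w) [CompleteLattice R] where
  assign : ∀ {τ : L.Ty}, Var L τ → RExpr L τ → R → R
  restr : R → Set (Vars L) → R
  guard : L.Cond → R → R
  lift : AbsAssign L A → R
  unlift : R → AbsAssign L A
  lift_bot : lift ⊥ = ⊥
  unlift_bot : unlift ⊥ = ⊥
  unlift_lift : ∀ s, s ≤ unlift (lift s)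
  restr_univ : ∀ r, r ≠ ⊥ → restr r Set.univ = r
  restr_empty : ∀ r, r ≠ ⊥ → restr r ∅ = ⊤
  restr_anti : ∀ r Y₁ Y₂, r ≠ ⊥ → Y₁ ⊆ Y₂ → restr r Y₂ ≤ restr r Y₁
  restr_restr : ∀ r Y₁ Y₂, r ≠ ⊥ → restr (restr r Y₁) Y₂ = restr r (Y₁ ∩ Y₂)
  unlift_restr_notMem : ∀ r Y y, r ≠ ⊥ → y ∉ Y → (unlift (restr r Y)).val y = ⊤
  unlift_restr_mem : ∀ r Y y, r ≠ ⊥ → y ∈ Y → (unlift (restr r Y)).val y = (unlift r).val y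
  γ : R → Set (Store L)
  γ_bot : γ ⊥ = ∅
  γ_mono : ∀ {r s : R}, r ≤ s → γ r ⊆ γ s
  γ_inf : ∀ r s : R, γ r ∩ γ s ⊆ γ (r ⊓ s)
  γ_assign : ∀ {τ : L.Ty} (y : Var L τ) (e : RExpr L τ) (r : R), ∀ σ ∈ γ r,
    Function.update σ ⟨τ, y⟩ (e.eval σ) ∈ γ (assign y e r)
  γ_restr : ∀ (r : R) (Y : Set (Vars L)), ∀ σ ∈ γ r, ∀ σ' : Store L, (∀ y ∈ Y, σ' y = σ y) →
    σ' ∈ γ (restr r Y)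
  γ_guard : ∀ (c : L.Cond) (r : R), ∀ σ ∈ γ r, L.holds c σ.locals → σ ∈ γ (guard c r)
  γ_lift : ∀ (s : AbsAssign L A) (σ : Store L), (∀ y, σ y ∈ V.γ (s.val y)) → σ ∈ γ (lift s)
  γ_unlift : ∀ r : R, ∀ σ ∈ γ r, ∀ y, σ y ∈ V.γ ((unlift r).val y)

/-! ### The analysis -/

/-- The set of all locals. -/
def localVars (L : Lang.{u}) : Set (Vars L) := {y | ∃ x : (Σ τ, L.X τ), y = ⟨x.1, .loc x.2⟩}

/-- A set of globals as a set of variables. -/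
def globVars {L : Lang.{u}} (Q : Set (Glob L)) : Set (Vars L) :=
  {y | ∃ g ∈ Q, y = ⟨g.1, .glob g.2⟩}

/-- Parameters of the analysis: protecting mutexes `prot g` of each global `g`, a non-empty finite
set of (finite) clusters of globals protected by `a` for each mutex `a`, the order in which the
globals of a cluster are initialized, the abstract id `i₀` of the main thread, and the function
`ν` computing abstract ids of created threads. -/
structure Params (L : Lang.{u}) (A : L.Ty → Type v) (R : Type w) where
  prot : Glob L → Set L.M
  clusters : L.M → Finset (Finset (Glob L))
  clusters_nonempty : ∀ a, (clusters a).Nonempty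
  clusters_prot : ∀ a, ∀ Q ∈ clusters a, ∀ g ∈ Q, a ∈ prot g
  enum : Finset (Glob L) → List (Glob L)
  mem_enum : ∀ Q g, g ∈ enum Q ↔ g ∈ Q
  i₀ : A L.tid
  ν : L.N → L.N → R → A L.tid

/-- Unknowns `[u,S]`, `[a,Q]`, `[i]` of the analysis. -/
inductive AUnknown (L : Lang.{u}) (A : L.Ty → Type v) : Type (max u v)
  | point (p : L.N) (S : Set L.M)
  | cluster (a : L.M) (Q : Finset (Glob L))
  | thread (i : A L.tid)

/-- Lockset after an action. -/
def Act.locksetAfter {L : Lang.{u}} (S : Set L.M) : Act L → Set L.M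
  | .lock a => insert a S
  | .unlock a => S \ {a}
  | _ => S

section Analysis

variable {L : Lang.{u}} {A : L.Ty → Type v} [∀ τ, CompleteLattice (A τ)]
  {V : ValueDomain L A} {R : Type w} [CompleteLattice R]

/-- Assignment of an abstract value to a variable. -/
def RelationalDomain.assignAbs (D : RelationalDomain L A V R) (y : Vars L) (a : A y.1) (r : R) :
    R :=
  D.restr r {y}ᶜ ⊓ D.lift (AbsAssign.topUpdate y a)

/-- Assignment of `0` to the listed globals, one by one. -/
def RelationalDomain.assignZeros (D : RelationalDomain L A V R) (l : List (Glob L)) (r : R) : R :=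
  l.foldl (fun r g => D.assign (.glob g.2) .zero r) r

variable (D : RelationalDomain L A V R) (B : Params L A R)

/-- The globals protected by some mutex in `S`. -/
def Params.protectedBy (B : Params L A R) (S : Set L.M) : Set (Glob L) :=
  {g | ∃ a ∈ S, a ∈ B.prot g}

/-- The variable `self` of the analysis. -/
def selfVar (L : Lang.{u}) : Vars L := ⟨L.tid, .loc L.self⟩

/-- The variable `ret` of the analysis. -/
def retVar (L : Lang.{u}) : Vars L := ⟨L.rty, .ret⟩

/-- Right-hand side for program start. -/
def initRhs : (AUnknown L A → R) × R :=
  (fun y => match y with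
    | .cluster a Q => if Q ∈ B.clusters a then D.assignZeros (B.enum Q) ⊤ else ⊥
    | _ => ⊥,
    D.assignAbs (selfVar L) B.i₀ ⊤)

/-- Right-hand side for an edge `act` leaving `p` when the lockset is `S` and the local state
`η [p,S]` is `r ≠ ⊥`. -/
def absRhsNonBot (p : L.N) (S : Set L.M) (act : Act L) (η : AUnknown L A → R) (r : R) :
    (AUnknown L A → R) × R :=
  match act with
  | .lock a => (⊥, r ⊓ ⨅ Q ∈ B.clusters a, η (.cluster a Q))
  | .unlock a =>
      (fun y => match y with
        | .cluster a' Q =>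
            if a' = a ∧ Q ∈ B.clusters a then D.restr r (globVars (Q : Set (Glob L))) else ⊥
        | _ => ⊥,
        D.restr r (localVars L ∪ globVars (B.protectedBy (S \ {a}))))
  | .read x g => (⊥, D.assign (.loc x) (.var (.glob g)) r)
  | .write g x => (⊥, D.assign (.glob g) (.var (.loc x)) r)
  | .assign x e => (⊥, D.assign (.loc x) (.expr e) r)
  | .havoc (τ := τ) x => (⊥, D.restr r {⟨τ, .loc x⟩}ᶜ)
  | .guard c => (⊥, D.guard c r)
  | .create x u₁ =>
      let i := B.ν p u₁ r
      (Function.update ⊥ (.point u₁ ∅) (D.restr (D.assignAbs (selfVar L) i r) (localVars L)),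
        D.assignAbs ⟨L.tid, .loc x⟩ i r)
  | .ret x =>
      (Function.update ⊥ (.thread ((D.unlift r).val (selfVar L)))
        (D.restr (D.assign .ret (.var (.loc x)) r) {retVar L}), r)
  | .join x x' =>
      let a : A L.rty := ⨆ (i : A L.tid) (_ : (D.unlift r).val ⟨L.tid, .loc x'⟩ ⊓ i ≠ ⊥),
        (D.unlift (η (.thread i))).val (retVar L)
      (⊥, D.assignAbs ⟨L.rty, .loc x⟩ a r)

/-- Right-hand side for an edge; it is strict in the local state. -/
def absRhs (p : L.N) (S : Set L.M) (act : Act L) (η : AUnknown L A → R) :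
    (AUnknown L A → R) × R :=
  if η (.point p S) = ⊥ then (⊥, ⊥) else absRhsNonBot D B p S act η (η (.point p S))

/-- Solutions of the constraint system of the analysis. -/
structure IsAbstractSolution (P : Prog L) (η : AUnknown L A → R) : Prop where
  init_side : (initRhs D B).1 ≤ η
  init : (initRhs D B).2 ≤ η (.point P.start ∅)
  edge_side : ∀ p act q S, P.edge p act q → (absRhs D B p S act η).1 ≤ η
  edge : ∀ p act q S, P.edge p act q →
    (absRhs D B p S act η).2 ≤ η (.point q (act.locksetAfter S))

/-! ### Concretizations -/

/-- The store `β t ∪ {ret ↦ c}`: locals at the sink of `t`, last values of globals in `t`. -/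
def Trace.store (t : Trace L) (c : L.Val L.rty) : Store L
  | ⟨τ, .loc x⟩ => t.sink.σ ⟨τ, x⟩
  | ⟨τ, .glob g⟩ => t.lastValue ⟨τ, g⟩
  | ⟨_, .ret⟩ => c

/-- Concretization for unknowns `[u,S]`. -/
def γPoint (P : Prog L) (p : L.N) (S : Set L.M) (r : R) : Set (Trace L) :=
  {t | Traces P t ∧ t.lockset t.sink = S ∧ t.sink.pt = p ∧ ∃ c, t.store c ∈ D.γ r}

/-- Concretization for unknowns `[i]`. -/
def γThread (P : Prog L) (r : R) : Set (Trace L) :=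
  {t | Traces P t ∧ ∃ x : L.X L.rty, t.Last (.ret x) ∧ t.store (t.sink.σ ⟨L.rty, x⟩) ∈ D.γ r}

/-- Concretization for unknowns `[a,Q]`. -/
def γMutex (P : Prog L) (a : L.M) (r : R) : Set (Trace L) :=
  {t | Traces P t ∧ (t.Last (.unlock a) ∨ t ∈ initTraces P) ∧ ∃ c, t.store c ∈ D.γ r}

/-- `ν` is sound with respect to the ids of created threads. -/
def SoundNu (P : Prog L) : Prop :=
  ∀ p u₁ S r, ∀ t ∈ γPoint D P p S r, ∀ t' ∈ newTraces P p u₁ t,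
    t'.sink.tid ∈ V.γ (B.ν p u₁ r)

/-- The assignment `η` to the abstract unknowns is sound: it describes all traces of the
collecting local trace semantics. -/
structure IsSound (P : Prog L) (η : AUnknown L A → R) : Prop where
  point : ∀ p S, {t ∈ collecting P (.point p) | t.lockset t.sink = S} ⊆
    γPoint D P p S (η (.point p S))
  thread : ∀ i, collecting P (.thread i) ⊆
    ⋃ j ∈ {j : A L.tid | i ∈ V.γ j}, γThread D P (η (.thread j))
  mutex : ∀ a, ∀ Q ∈ B.clusters a, collecting P (.mutex a) ⊆ γMutex D P a (η (.cluster a Q))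

end Analysis

end

end LocalTraces

open LocalTraces

/-!
The proof is an induction over the rules that generate the collecting semantics
(`mem_collecting_iff`), with a claim `Covers` that is stronger than soundness. A trace `t` ending at
program point `p` with lock set `S` is required to be described by the abstract value of `[p, S]`
together with all variations of its store at the globals that are neither protected by `S` nor
accessed by the last action: these are the globals other threads may change without the ego thread
noticing. Similarly, the value of `[a, Q]` must contain all stores that agree with `t` on `Q`.
Since every access to a global is followed by an unlock, whose abstract effect forgets the
unprotected globals, this claim survives each action of a single thread (`covers_unary`).

The main difficulty lies in the actions `lock(a)` and `join`, which incorporate another trace `t₁`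
into the trace `t₀` of the ego thread and thereby may change the last values of globals.

* The globals protected by a mutex held at the sink of `t₀` keep their value from `t₀`
  (`Trace.lastValue_eq_of_lockset`), so the local state still describes the new trace.
* At `lock(a)`, the globals protected by `a` have their value from `t₁`
  (`Trace.lastValue_eq_of_locks`), so all clusters of `a` describe the new trace too.

Both rest on mutual exclusion, `Trace.Disciplined.releases_or_releases`: since locking order is
injective in both directions, the acquisitions of a mutex form a single chain, and of two critical
sections one is left before the other is entered. A write to `g` takes place within critical
sections of all mutexes protecting `g`, hence lies causally below the sink of the trace in question.
Finally, a local trace contained in another one is closed under causal predecessors in it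
(`Trace.Sub.le_of_mem`), so it contains these writes in the same order.

The hypotheses on unlocking and on writes concern the sinks of collected traces. They carry over to
the interior of traces because every edge was once appended at the sink of a collected subtrace
(`Collects.history`). The hypothesis on `ν` concerns start traces of created threads; it applies to
the creating thread as well since an id that can be stored by a create action can also be given to a
started thread (`Trace.IsLocal.spawn`).
-/

namespace LocalTraces

open scoped Classical

/-! ### The collecting semantics as an inductive predicate -/

section Collecting

variable {L : Lang.{u}} {P : Prog L}

/-- The collecting semantics presented by rules: `Collects P k t` says that the trace `t` belongs to
the value of the unknown `k` in the least solution of the concrete constraint system. -/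
inductive Collects (P : Prog L) : CUnknown L → Trace L → Prop
  | init {t} : t ∈ initTraces P → Collects P (.point P.start) t
  | initMutex {t} (a : L.M) : t ∈ initTraces P → Collects P (.mutex a) t
  | unary {p act q t t'} : P.edge p act q → (∀ a, act ≠ .lock a) → (∀ x x', act ≠ .join x x') →
      Collects P (.point p) t → t' ∈ sem₁ P p act q t → Collects P (.point q) t'
  | lock {p a q t₀ t₁ t'} : P.edge p (.lock a) q → Collects P (.point p) t₀ →
      Collects P (.mutex a) t₁ → t' ∈ semLock P p a q t₀ t₁ → Collects P (.point q) t'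
  | join {p x x' q t₀ t t₁ t'} : P.edge p (.join x x') q → Collects P (.point p) t₀ →
      Collects P (.point p) t → Collects P (.thread (t.sink.σ ⟨L.tid, x'⟩)) t₁ →
      t' ∈ semJoin P p x x' q t₀ t₁ → Collects P (.point q) t'
  | unlockSide {p a q t t'} : P.edge p (.unlock a) q → Collects P (.point p) t →
      t' ∈ sem₁ P p (.unlock a) q t → Collects P (.mutex a) t'
  | createSide {p x u₁ q t t'} : P.edge p (.create x u₁) q → Collects P (.point p) t →
      t' ∈ newTraces P p u₁ t → Collects P (.point u₁) t'
  | retSide {p x q t t'} : P.edge p (.ret x) q → Collects P (.point p) t →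
      t' ∈ sem₁ P p (.ret x) q t → Collects P (.thread t.sink.tid) t'

theorem isConcreteSolution_collects :
    IsConcreteSolution P (fun k => {t | Collects P k t}) where
  init_side a t ht := .initMutex a ht
  init t ht := .init ht
  edge_side p act q e := by
    cases act <;> simp only [concreteRhs] <;> try exact bot_le
    · intro k
      rcases eq_or_ne k (.mutex ‹_›) with rfl | hk
      · rw [Function.update_self]
        rintro t ⟨t₀, h₀, h⟩
        exact .unlockSide e h₀ h
      · rw [Function.update_of_ne hk]; exact bot_le
    · intro k
      rcases eq_or_ne k (.point ‹_›) with rfl | hk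
      · rw [Function.update_self]
        rintro t ⟨t₀, h₀, h⟩
        exact .createSide e h₀ h
      · rw [Function.update_of_ne hk]; exact bot_le
    · intro k
      cases k <;> try exact Set.empty_subset _
      rintro t ⟨t₀, ⟨h₀, rfl⟩, h⟩
      exact .retSide e h₀ h
  edge p act q e := by
    cases act <;> simp only [concreteRhs]
    case lock => rintro t ⟨t₀, h₀, t₁, h₁, h⟩; exact .lock e h₀ h₁ h
    case join =>
      rintro t ⟨t₀, h₀, t₁, h₁, h⟩
      simp only [Set.mem_iUnion] at h₁
      obtain ⟨t₂, h₂, h₁⟩ := h₁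
      exact .join e h₀ h₂ h₁ h
    all_goals
      rintro t ⟨t₀, h₀, h⟩
      exact .unary e (by simp) (by simp) h₀ h

theorem mem_collecting_iff {k : CUnknown L} {t : Trace L} :
    t ∈ collecting P k ↔ Collects P k t := by
  refine ⟨fun h => (collecting_isLeast P).2 (isConcreteSolution_collects (P := P)) k h, fun h => ?_⟩
  have hs := (collecting_isLeast P).1
  induction h with
  | init ht => exact hs.init ht
  | initMutex a ht => exact hs.init_side a ht
  | @unary p act q t t' e hl hj _ h ih =>
    refine hs.edge p act q e ?_
    cases act <;> simp only [concreteRhs]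
    case lock a => exact absurd rfl (hl a)
    case join x x' => exact absurd rfl (hj x x')
    all_goals exact ⟨t, ih, h⟩
  | lock e _ _ h ih₀ ih₁ => exact hs.edge _ _ _ e ⟨_, ih₀, _, ih₁, h⟩
  | join e _ _ _ h ih₀ ih ih₁ =>
    refine hs.edge _ _ _ e ⟨_, ih₀, _, ?_, h⟩
    simp only [Set.mem_iUnion]
    exact ⟨_, ih, ih₁⟩
  | unlockSide e _ h ih =>
    refine hs.edge_side _ _ _ e _ ?_
    simp only [concreteRhs, Function.update_self]
    exact ⟨_, ih, h⟩
  | createSide e _ h ih =>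
    refine hs.edge_side _ _ _ e _ ?_
    simp only [concreteRhs, Function.update_self]
    exact ⟨_, ih, h⟩
  | retSide e _ h ih => exact hs.edge_side _ _ _ e _ ⟨_, ⟨ih, rfl⟩, h⟩

theorem Collects.traces {k : CUnknown L} {t : Trace L} (h : Collects P k t) : Traces P t := by
  induction h with
  | init ht => exact .init ht
  | initMutex a ht => exact .init ht
  | unary e hl hj _ h ih => exact .unary e hl hj ih h
  | lock e _ _ h ih₀ ih₁ => exact .lock e ih₀ ih₁ h
  | join e _ _ _ h ih₀ _ ih₁ => exact .join e ih₀ ih₁ h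
  | unlockSide e _ h ih => exact .unary e (by simp) (by simp) ih h
  | createSide e _ h ih => exact .create e ih h
  | retSide e _ h ih => exact .unary e (by simp) (by simp) ih h

theorem isLocal_of_mem_initTraces {t : Trace L} (ht : t ∈ initTraces P) : t.IsLocal P := by
  obtain ⟨σ, hσ, rfl⟩ := ht
  have hle : ∀ m n, (Trace.single (⟨0, P.start, σ⟩ : Node L)).Le m n → m = n := by
    intro m n h
    induction h with
    | refl => rfl
    | tail _ h => simp [Trace.Prec, Trace.single] at h
  constructor <;> try
    simp [Trace.single, Trace.IsJoin, Trace.IsLock, Trace.Allocates, Node.IsZero, Node.tid, hσ]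
  · exact fun m n h _ => hle m n h
  · exact .refl
  · exact .refl

theorem Collects.isLocal {k : CUnknown L} {t : Trace L} (h : Collects P k t) : t.IsLocal P := by
  cases h with
  | init ht => exact isLocal_of_mem_initTraces ht
  | initMutex a ht => exact isLocal_of_mem_initTraces ht
  | unary _ _ _ _ h => obtain ⟨-, _, -, h, -⟩ := h; exact h
  | lock _ _ _ h => obtain ⟨-, _, -, h⟩ := h; exact h
  | join _ _ _ _ h => obtain ⟨-, _, -, h⟩ := h; exact h
  | unlockSide _ _ h => obtain ⟨-, _, -, h, -⟩ := h; exact h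
  | createSide _ _ h => obtain ⟨-, _, _, -, h⟩ := h; exact h
  | retSide _ _ h => obtain ⟨-, _, -, h, -⟩ := h; exact h

theorem Collects.pt_eq {p : L.N} {t : Trace L} (h : Collects P (.point p) t) : t.sink.pt = p := by
  cases h with
  | init ht => obtain ⟨σ, -, rfl⟩ := ht; rfl
  | unary _ _ _ _ h => obtain ⟨-, _, rfl, -⟩ := h; rfl
  | lock _ _ _ h => obtain ⟨-, _, rfl, -⟩ := h; rfl
  | join _ _ _ _ h => obtain ⟨-, _, rfl, -⟩ := h; rfl
  | createSide _ _ h => obtain ⟨-, _, _, rfl, -⟩ := h; rfl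

end Collecting

/-! ### Causality and lock sets in local traces -/

namespace Trace.IsLocal

variable {L : Lang.{u}} {P : Prog L} {t : Trace L}

theorem le_of_edge {m n : Node L} {act : Act L} (h : (m, act, n) ∈ t.edges) : t.Le m n :=
  .single (.inl ⟨act, h⟩)

theorem le_of_idx_le (ht : t.IsLocal P) {m n : Node L} (hm : m ∈ t.nodes) (hn : n ∈ t.nodes)
    (htid : m.tid = n.tid) (h : m.idx ≤ n.idx) : t.Le m n := by
  obtain ⟨k, hk⟩ := Nat.exists_eq_add_of_le h
  clear h
  induction k generalizing n with
  | zero => rw [ht.node_unique m hm n hn htid (by omega)]; exact .refl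
  | succ k ih =>
    obtain ⟨n', act, he⟩ := ht.edge_exists n hn (by omega)
    obtain ⟨hn', -, hi, ht', -⟩ := ht.edge_step _ _ _ he
    exact (ih hn' (htid.trans ht') (by omega)).trans (le_of_edge he)

theorem idx_le_of_le (ht : t.IsLocal P) {m n : Node L} (hm : m ∈ t.nodes) (hn : n ∈ t.nodes)
    (htid : m.tid = n.tid) (h : t.Le m n) : m.idx ≤ n.idx := by
  by_contra hlt
  have := ht.antisymm _ _ h (ht.le_of_idx_le hn hm htid.symm (by omega))
  subst this
  omega

theorem not_edge_sink (ht : t.IsLocal P) {act : Act L} {n : Node L} :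
    (t.sink, act, n) ∉ t.edges := by
  intro h
  obtain ⟨hm, hn, hi, htid, -⟩ := ht.edge_step _ _ _ h
  have := ht.idx_le_of_le hn hm htid (ht.le_sink n hn)
  omega

theorem mem_of_prec (ht : t.IsLocal P) {m n : Node L} (h : t.Prec m n) :
    m ∈ t.nodes ∧ n ∈ t.nodes := by
  rcases h with ⟨act, h⟩ | h | h | ⟨a, h⟩
  · obtain ⟨hm, hn, -⟩ := ht.edge_step _ _ _ h
    exact ⟨hm, hn⟩
  · obtain ⟨hm, hn, -⟩ := ht.create_mem _ _ h
    exact ⟨hm, hn⟩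
  · obtain ⟨⟨r, x, hr⟩, ⟨r', x₁, x₂, hj⟩⟩ := ht.join_mem _ _ h
    exact ⟨(ht.edge_step _ _ _ hr).2.1, (ht.edge_step _ _ _ hj).2.1⟩
  · obtain ⟨hm, ⟨l, hl⟩⟩ := ht.lock_mem _ _ _ h
    refine ⟨?_, (ht.edge_step _ _ _ hl).2.1⟩
    rcases hm with ⟨r, hr⟩ | hm
    · exact (ht.edge_step _ _ _ hr).2.1
    · exact hm.1

theorem finite_le (ht : t.IsLocal P) {n : Node L} (hn : n ∈ t.nodes) : {m | t.Le m n}.Finite := by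
  refine ht.finite.subset fun m hm => ?_
  rcases Relation.ReflTransGen.cases_head hm with rfl | ⟨k, hk, -⟩
  · exact hn
  · exact (ht.mem_of_prec hk).1

/-- The start node of the main thread has no strict predecessor. -/
theorem eq_of_le_isZero (ht : t.IsLocal P) {m z : Node L} (hz : z ∈ t.nodes) (hzero : z.IsZero)
    (h : t.Le m z) (hm : m ∈ t.nodes) : m = z := by
  obtain ⟨z', hz', hzero', -, hle⟩ := ht.least
  obtain rfl := ht.node_unique z' hz' z hz (hzero'.2.trans hzero.2.symm)
    (hzero'.1.trans hzero.1.symm)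
  exact ht.antisymm _ _ h (hle m hm)

/-- The mutexes held after an action are determined by those held before it. -/
theorem lockset_of_edge (ht : t.IsLocal P) {m n : Node L} {act : Act L}
    (h : (m, act, n) ∈ t.edges) : t.lockset n = act.locksetAfter (t.lockset m) := by
  obtain ⟨-, hn, hi, htid, -⟩ := ht.edge_step _ _ _ h
  -- An edge of the thread into a node up to `n` ends at a node up to `m`, or is the given one.
  have key : ∀ {k l act'}, (k, act', l) ∈ t.edges → l.tid = n.tid → l.idx ≤ n.idx →
      l.idx ≤ m.idx ∨ (l = n ∧ act' = act) := by
    intro k l act' he hl hle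
    by_cases hlm : l.idx ≤ m.idx
    · exact .inl hlm
    · obtain rfl := ht.node_unique l (ht.edge_step _ _ _ he).2.1 n hn hl (by omega)
      exact .inr ⟨rfl, (ht.edge_unique _ _ _ _ _ he h).2⟩
  have fwd : ∀ b, b ∈ t.lockset n → act ≠ .lock b → b ∈ t.lockset m := by
    rintro b ⟨k, l, he, hl, hle, hu⟩ hne
    rcases key he hl hle with hle' | ⟨-, h'⟩
    · exact ⟨k, l, he, hl.trans htid, hle', fun k' l' he' hl' hle' =>
        hu k' l' he' (hl'.trans htid.symm) (by omega)⟩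
    · exact absurd h'.symm hne
  have bwd : ∀ b, b ∈ t.lockset m → act ≠ .unlock b → b ∈ t.lockset n := by
    rintro b ⟨k, l, he, hl, hle, hu⟩ hne
    refine ⟨k, l, he, hl.trans htid.symm, by omega, fun k' l' he' hl' hle' => ?_⟩
    rcases key he' hl' hle' with hle'' | ⟨-, h'⟩
    · exact hu k' l' he' (hl'.trans htid) hle''
    · exact absurd h'.symm hne
  ext b
  cases act with
  | lock a =>
    simp only [Act.locksetAfter, Set.mem_insert_iff]
    constructor
    · intro hb
      by_cases hab : b = a
      · exact .inl hab
      · exact .inr (fwd b hb (by simpa using fun h => hab h.symm))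
    · rintro (rfl | hb)
      · refine ⟨m, n, h, rfl, le_rfl, fun k' l' he' hl' hle' => ?_⟩
        rcases key he' hl' hle' with hle'' | ⟨-, h'⟩
        · omega
        · simp at h'
      · exact bwd b hb (by simp)
  | unlock a =>
    simp only [Act.locksetAfter, Set.mem_sdiff, Set.mem_singleton_iff]
    constructor
    · intro hb
      refine ⟨fwd b hb (by simp), ?_⟩
      rintro rfl
      obtain ⟨k, l, he, hl, hle, hu⟩ := hb
      have := hu m n h rfl le_rfl
      omega
    · rintro ⟨hb, hab⟩
      exact bwd b hb (by simpa using fun h => hab h.symm)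
  | _ => exact ⟨fun hb => fwd b hb (by simp), fun hb => bwd b hb (by simp)⟩

end Trace.IsLocal

/-! ### Subtraces -/

namespace Trace

variable {L : Lang.{u}} {P : Prog L} {s t : Trace L}

/-- All nodes and edges of `s` occur in `t`. Between local traces this makes `s` closed under
causal predecessors in `t`. -/
structure Sub (s t : Trace L) : Prop where
  nodes : s.nodes ⊆ t.nodes
  edges : s.edges ⊆ t.edges
  creates : ∀ {m n}, s.creates m n → t.creates m n
  joins : ∀ {m n}, s.joins m n → t.joins m n
  locks : ∀ {a m n}, s.locks a m n → t.locks a m n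

namespace Sub

theorem trans {r : Trace L} (h : r.Sub s) (h' : s.Sub t) : r.Sub t :=
  ⟨h.nodes.trans h'.nodes, h.edges.trans h'.edges, fun x => h'.creates (h.creates x),
    fun x => h'.joins (h.joins x), fun x => h'.locks (h.locks x)⟩

theorem prec (h : s.Sub t) {m n : Node L} (hp : s.Prec m n) : t.Prec m n := by
  rcases hp with ⟨act, hp⟩ | hp | hp | ⟨a, hp⟩
  · exact .inl ⟨act, h.edges hp⟩
  · exact .inr (.inl (h.creates hp))
  · exact .inr (.inr (.inl (h.joins hp)))
  · exact .inr (.inr (.inr ⟨a, h.locks hp⟩))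

theorem le (h : s.Sub t) {m n : Node L} (hp : s.Le m n) : t.Le m n := by
  induction hp with
  | refl => exact .refl
  | tail _ hp ih => exact ih.tail (h.prec hp)

variable (hs : s.IsLocal P) (ht : t.IsLocal P) (h : s.Sub t)
include hs ht h

theorem edge_of_mem {m n : Node L} {act : Act L} (hn : n ∈ s.nodes)
    (he : (m, act, n) ∈ t.edges) : (m, act, n) ∈ s.edges := by
  obtain ⟨m', act', he'⟩ := hs.edge_exists n hn (by have := ht.edge_step _ _ _ he; omega)
  obtain ⟨rfl, rfl⟩ := ht.edge_unique _ _ _ _ _ he (h.edges he')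
  exact he'

theorem prec_of_mem {m n : Node L} (hn : n ∈ s.nodes) (hp : t.Prec m n) : s.Prec m n := by
  rcases hp with ⟨act, hp⟩ | hp | hp | ⟨a, hp⟩
  · exact .inl ⟨act, h.edge_of_mem hs ht hn hp⟩
  · obtain ⟨-, hn', hi, hz, -⟩ := ht.create_mem _ _ hp
    obtain ⟨z, hz', -⟩ := hs.create_unique n hn hi hz
    rw [(ht.create_unique n hn' hi hz).unique hp (h.creates hz')]
    exact .inr (.inl hz')
  · have hj := (ht.join_mem _ _ hp).2
    obtain ⟨k, x, x', hk⟩ := hj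
    obtain ⟨r, hr, -⟩ := hs.join_unique n ⟨k, x, x', h.edge_of_mem hs ht hn hk⟩
    rw [(ht.join_unique n ⟨k, x, x', hk⟩).unique hp (h.joins hr)]
    exact .inr (.inr (.inl hr))
  · have hj := (ht.lock_mem _ _ _ hp).2
    obtain ⟨k, hk⟩ := hj
    obtain ⟨r, hr, -⟩ := hs.lock_unique a n ⟨k, h.edge_of_mem hs ht hn hk⟩
    rw [(ht.lock_unique a n ⟨k, hk⟩).unique hp (h.locks hr)]
    exact .inr (.inr (.inr ⟨a, hr⟩))

theorem le_of_mem {m n : Node L} (hn : n ∈ s.nodes) (hp : t.Le m n) :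
    s.Le m n ∧ m ∈ s.nodes := by
  induction hp using Relation.ReflTransGen.head_induction_on with
  | refl => exact ⟨.refl, hn⟩
  | head hp _ ih =>
    have := h.prec_of_mem hs ht ih.2 hp
    exact ⟨.head this ih.1, (hs.mem_of_prec this).1⟩

theorem lockset_eq {z : Node L} (hz : z ∈ s.nodes) : t.lockset z = s.lockset z := by
  have key : ∀ {m act n}, (m, act, n) ∈ t.edges → n.tid = z.tid → n.idx ≤ z.idx →
      (m, act, n) ∈ s.edges := fun he htid hle =>
    h.edge_of_mem hs ht (h.le_of_mem hs ht hz
      (ht.le_of_idx_le (ht.edge_step _ _ _ he).2.1 (h.nodes hz) htid hle)).2 he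
  ext a
  constructor
  · rintro ⟨m, n, he, htid, hle, hu⟩
    exact ⟨m, n, key he htid hle, htid, hle, fun m' n' he' => hu m' n' (h.edges he')⟩
  · rintro ⟨m, n, he, htid, hle, hu⟩
    exact ⟨m, n, h.edges he, htid, hle, fun m' n' he' h₁ h₂ => hu m' n' (key he' h₁ h₂) h₁ h₂⟩

end Sub

/-! ### Last values of globals -/

theorem lastValue_of_isLastWrite (ht : t.IsLocal P) {τ : L.Ty} {g : L.G τ} {p q : Node L}
    {y : L.X τ} (h : t.IsLastWrite t.sink g p y q) : t.lastValue ⟨τ, g⟩ = p.σ ⟨τ, y⟩ := by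
  have hex : ∃ e : Node L × L.X τ × Node L, t.IsLastWrite t.sink g e.1 e.2.1 e.2.2 := ⟨(p, y, q), h⟩
  have hc := hex.choose_spec
  have hq : hex.choose.2.2 = q :=
    ht.antisymm _ _ (h.2.2 _ _ _ hc.1 hc.2.1) (hc.2.2 _ _ _ h.1 h.2.1)
  obtain ⟨hp, ha⟩ := ht.edge_unique _ _ _ _ _ hc.1 (hq ▸ h.1)
  have hy : hex.choose.2.1 = y := by simpa using ha
  rw [lastValue, dif_pos hex, hp, hy]

theorem lastValue_of_no_write {τ : L.Ty} {g : L.G τ}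
    (h : ∀ p y q, (p, .write g y, q) ∉ t.edges) : t.lastValue ⟨τ, g⟩ = L.zero τ := by
  rw [lastValue, dif_neg]
  rintro ⟨e, he⟩
  exact h _ _ _ he.1

/-- If a subtrace contains all writes to a global, both traces agree on its last value. -/
theorem Sub.lastValue_eq (hs : s.IsLocal P) (ht : t.IsLocal P) (h : s.Sub t) {τ : L.Ty} {g : L.G τ}
    (hw : ∀ p y q, (p, .write g y, q) ∈ t.edges → q ∈ s.nodes) :
    t.lastValue ⟨τ, g⟩ = s.lastValue ⟨τ, g⟩ := by
  have key : ∀ p y q, t.IsLastWrite t.sink g p y q ↔ s.IsLastWrite s.sink g p y q := by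
    intro p y q
    constructor
    · rintro ⟨he, -, hl⟩
      have hq := hw _ _ _ he
      exact ⟨h.edge_of_mem hs ht hq he, hs.le_sink q hq, fun p' y' q' he' _ =>
        (h.le_of_mem hs ht hq (hl p' y' q' (h.edges he')
          (ht.le_sink _ (ht.edge_step _ _ _ (h.edges he')).2.1))).1⟩
    · rintro ⟨he, -, hl⟩
      refine ⟨h.edges he, ht.le_sink _ (ht.edge_step _ _ _ (h.edges he)).2.1,
        fun p' y' q' he' _ => ?_⟩
      have hq' := hw _ _ _ he'
      exact h.le (hl p' y' q' (h.edge_of_mem hs ht hq' he') (hs.le_sink q' hq'))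
  by_cases hex : ∃ p y q, s.IsLastWrite s.sink g p y q
  · obtain ⟨p, y, q, hl⟩ := hex
    rw [lastValue_of_isLastWrite hs hl, lastValue_of_isLastWrite ht ((key p y q).2 hl)]
  · rw [lastValue, lastValue, dif_neg fun ⟨e, he⟩ => hex ⟨_, _, _, (key _ _ _).1 he⟩,
      dif_neg fun ⟨e, he⟩ => hex ⟨_, _, _, he⟩]

end Trace

/-! ### Histories of the edges of a trace -/

namespace Trace

variable {L : Lang.{u}} (t t₀ t₁ : Trace L) (act : Act L) (a : L.M) (m n : Node L)

theorem sub_extend : t.Sub (t.extend act n) :=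
  ⟨Set.subset_insert _ _, Set.subset_insert _ _, id, id, id⟩

theorem sub_spawn : t.Sub (t.spawn n) :=
  ⟨Set.subset_insert _ _, subset_rfl, .inl, id, id⟩

theorem sub_addLock_left : t₀.Sub (((t₀.union t₁).extend act n).addLock a m n) :=
  ⟨fun _ h => .inr (.inl h), fun _ h => .inr (.inl h), .inl, .inl, fun h => .inl (.inl h)⟩

theorem sub_addLock_right : t₁.Sub (((t₀.union t₁).extend act n).addLock a m n) :=
  ⟨fun _ h => .inr (.inr h), fun _ h => .inr (.inr h), .inr, .inr, fun h => .inl (.inr h)⟩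

theorem sub_addJoin_left : t₀.Sub (((t₀.union t₁).extend act n).addJoin m n) :=
  ⟨fun _ h => .inr (.inl h), fun _ h => .inr (.inl h), .inl, fun h => .inl (.inl h), .inl⟩

theorem sub_addJoin_right : t₁.Sub (((t₀.union t₁).extend act n).addJoin m n) :=
  ⟨fun _ h => .inr (.inr h), fun _ h => .inr (.inr h), .inr, fun h => .inl (.inr h), .inr⟩

end Trace

section History

variable {L : Lang.{u}} {P : Prog L}

/-- Every edge of a collected trace was appended to a collected trace that survives as a subtrace.
Hence properties assumed of collected traces before an action hold at all occurrences of it. -/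
theorem Collects.history {k : CUnknown L} {t : Trace L} (h : Collects P k t) :
    ∀ m act n, (m, act, n) ∈ t.edges →
      ∃ s, Collects P (.point m.pt) s ∧ s.sink = m ∧ s.Sub t := by
  have unary : ∀ {p act q} {t t' : Trace L}, Collects P (.point p) t →
      t' ∈ sem₁ P p act q t → (∀ m act n, (m, act, n) ∈ t.edges →
        ∃ s, Collects P (.point m.pt) s ∧ s.sink = m ∧ s.Sub t) →
      ∀ m act n, (m, act, n) ∈ t'.edges →
        ∃ s, Collects P (.point m.pt) s ∧ s.sink = m ∧ s.Sub t' := by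
    rintro p act q t t' hc ⟨hp, σ, rfl, -⟩ ih m act' n (he | he)
    · cases he
      exact ⟨t, hp ▸ hc, rfl, t.sub_extend _ _⟩
    · obtain ⟨s, hs, rfl, hsub⟩ := ih m act' n he
      exact ⟨s, hs, rfl, hsub.trans (t.sub_extend _ _)⟩
  induction h with
  | init ht => obtain ⟨σ, -, rfl⟩ := ht; exact fun _ _ _ h => h.elim
  | initMutex a ht => obtain ⟨σ, -, rfl⟩ := ht; exact fun _ _ _ h => h.elim
  | unary e _ _ hc h ih => exact unary hc h ih
  | unlockSide e hc h ih => exact unary hc h ih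
  | retSide e hc h ih => exact unary hc h ih
  | createSide e hc h ih =>
    obtain ⟨hp, i, -, rfl, -⟩ := h
    intro m act n he
    obtain ⟨s, hs, rfl, hsub⟩ := ih m act n he
    exact ⟨s, hs, rfl, hsub.trans (Trace.sub_spawn _ _)⟩
  | @lock p a q t₀ t₁ t' e hc hc₁ h ih ih₁ =>
    obtain ⟨hp, σ, rfl, -⟩ := h
    rintro m act n (he | he | he)
    · cases he
      exact ⟨t₀, hp ▸ hc, rfl, Trace.sub_addLock_left ..⟩
    · obtain ⟨s, hs, rfl, hsub⟩ := ih m act n he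
      exact ⟨s, hs, rfl, hsub.trans (Trace.sub_addLock_left ..)⟩
    · obtain ⟨s, hs, rfl, hsub⟩ := ih₁ m act n he
      exact ⟨s, hs, rfl, hsub.trans (Trace.sub_addLock_right ..)⟩
  | @join p x x' q t₀ t t₁ t' e hc _ hc₁ h ih _ ih₁ =>
    obtain ⟨hp, σ, rfl, -⟩ := h
    rintro m act n (he | he | he)
    · cases he
      exact ⟨t₀, hp ▸ hc, rfl, Trace.sub_addJoin_left ..⟩
    · obtain ⟨s, hs, rfl, hsub⟩ := ih m act n he
      exact ⟨s, hs, rfl, hsub.trans (Trace.sub_addJoin_left ..)⟩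
    · obtain ⟨s, hs, rfl, hsub⟩ := ih₁ m act n he
      exact ⟨s, hs, rfl, hsub.trans (Trace.sub_addJoin_right ..)⟩

/-- In `t`, threads release only mutexes they hold, and write a global only while holding all
mutexes that protect it. -/
structure Trace.Disciplined (prot : Glob L → Set L.M) (t : Trace L) : Prop where
  unlock : ∀ {m a n}, (m, .unlock a, n) ∈ t.edges → a ∈ t.lockset m
  write : ∀ {m n} {τ : L.Ty} {g : L.G τ} {x : L.X τ}, (m, .write g x, n) ∈ t.edges →
    prot ⟨τ, g⟩ ⊆ t.lockset m

theorem Collects.disciplined {prot : Glob L → Set L.M} (hunlock : ProperUnlocking P)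
    (hprot : Protects P prot) {k : CUnknown L} {t : Trace L} (h : Collects P k t) :
    t.Disciplined prot where
  unlock {m a n} he := by
    obtain ⟨s, hs, rfl, hsub⟩ := h.history _ _ _ he
    rw [hsub.lockset_eq hs.isLocal h.isLocal hs.isLocal.sink_mem]
    exact hunlock _ _ _ (h.isLocal.edge_step _ _ _ he).2.2.2.2.1 s (mem_collecting_iff.2 hs)
  write {m n τ g x} he := by
    obtain ⟨s, hs, rfl, hsub⟩ := h.history _ _ _ he
    rw [hsub.lockset_eq hs.isLocal h.isLocal hs.isLocal.sink_mem]
    exact hprot _ _ _ _ _ (h.isLocal.edge_step _ _ _ he).2.2.2.2.1 s (mem_collecting_iff.2 hs)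

end History

/-! ### Mutual exclusion -/

namespace Trace

variable {L : Lang.{u}} {P : Prog L} {t : Trace L} {prot : Glob L → Set L.M}

/-- The node `z` lies in the critical section of `a` entered at `l`: its thread has acquired `a` at
`l` and has not released it since. -/
structure Holds (t : Trace L) (a : L.M) (l z : Node L) : Prop where
  isLock : t.IsLock a l
  tid : l.tid = z.tid
  idx : l.idx ≤ z.idx
  not_unlocked : ∀ m n, (m, .unlock a, n) ∈ t.edges → n.tid = z.tid → n.idx ≤ z.idx → n.idx < l.idx

theorem mem_lockset_iff {a : L.M} {z : Node L} : a ∈ t.lockset z ↔ ∃ l, t.Holds a l z :=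
  ⟨fun ⟨_, l, he, htid, hle, hu⟩ => ⟨l, ⟨_, he⟩, htid, hle, hu⟩,
    fun ⟨l, ⟨m, he⟩, htid, hle, hu⟩ => ⟨m, l, he, htid, hle, hu⟩⟩

/-- The critical section of `a` entered at `l` is left at `u`. -/
def Releases (t : Trace L) (a : L.M) (l u : Node L) : Prop :=
  ∃ m, (m, .unlock a, u) ∈ t.edges ∧ t.Holds a l m

theorem IsLock.mem (ht : t.IsLocal P) {a : L.M} {l : Node L} (h : t.IsLock a l) : l ∈ t.nodes := by
  obtain ⟨m, h⟩ := h
  exact (ht.edge_step _ _ _ h).2.1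

namespace Releases

variable {a : L.M} {l u : Node L}

theorem mem (ht : t.IsLocal P) (h : t.Releases a l u) : u ∈ t.nodes := by
  obtain ⟨m, h, -⟩ := h
  exact (ht.edge_step _ _ _ h).2.1

theorem tid_eq (ht : t.IsLocal P) (h : t.Releases a l u) : l.tid = u.tid := by
  obtain ⟨m, h, hm⟩ := h
  exact hm.tid.trans (ht.edge_step _ _ _ h).2.2.2.1.symm

theorem idx_lt (ht : t.IsLocal P) (h : t.Releases a l u) : l.idx < u.idx := by
  obtain ⟨m, h, hm⟩ := h
  have := (ht.edge_step _ _ _ h).2.2.1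
  have := hm.idx
  omega

theorem le (ht : t.IsLocal P) (h : t.Releases a l u) : t.Le l u := by
  have hl : l ∈ t.nodes := by obtain ⟨m, -, hm⟩ := h; exact hm.isLock.mem ht
  exact ht.le_of_idx_le hl (h.mem ht) (h.tid_eq ht) (h.idx_lt ht).le

theorem unique (ht : t.IsLocal P) {u' : Node L} (h : t.Releases a l u) (h' : t.Releases a l u') :
    u = u' := by
  have key : ∀ {u u'}, t.Releases a l u → t.Releases a l u' → ¬ u.idx < u'.idx := by
    intro u u' h h' hlt
    have h₁ := h.tid_eq ht
    have h₂ := h.idx_lt ht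
    obtain ⟨m, he, -⟩ := h
    obtain ⟨m', he', hm'⟩ := h'
    have := (ht.edge_step _ _ _ he').2.2.1
    have := hm'.not_unlocked _ _ he (h₁.symm.trans hm'.tid) (by omega)
    omega
  have h₁ := key h h'
  have h₂ := key h' h
  exact ht.node_unique _ (h.mem ht) _ (h'.mem ht) ((h.tid_eq ht).symm.trans (h'.tid_eq ht))
    (by omega)

/-- Nodes in a critical section, and their immediate successors, precede its end. -/
theorem idx_succ_le (ht : t.IsLocal P) {z : Node L} (h : t.Releases a l u) (hz : t.Holds a l z) :
    z.idx + 1 ≤ u.idx := by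
  by_contra hlt
  have h₁ := h.tid_eq ht
  have h₂ := h.idx_lt ht
  obtain ⟨m, he, -⟩ := h
  have := hz.not_unlocked _ _ he (h₁.symm.trans hz.tid) (by omega)
  omega

end Releases

theorem IsLock.le_of_locks {a : L.M} {m l : Node L} (h : t.locks a m l) : t.Le m l :=
  .single (.inr (.inr (.inr ⟨a, h⟩)))

/-- Mutual exclusion: of two critical sections of the same mutex, one is left before the other is
entered. Following locking order backwards, the acquisitions of a mutex form a chain that starts at
the start of the main thread; this chain does not branch since each release has at most one
successor in locking order. -/
theorem Disciplined.releases_or_releases (hd : t.Disciplined prot) (ht : t.IsLocal P) {a : L.M} :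
    ∀ {l l' m m' : Node L}, l ≠ l' → t.locks a m l → t.locks a m' l' →
      (∃ u, t.Releases a l u ∧ t.Le u m') ∨ (∃ u, t.Releases a l' u ∧ t.Le u m) := by
  -- Induction on the number of nodes below `l` and below `l'`.
  have rank_lt : ∀ {x y : Node L}, t.Le x y → x ≠ y → y ∈ t.nodes →
      {k | t.Le k x}.ncard < {k | t.Le k y}.ncard := by
    intro x y hxy hne hy
    refine Set.ncard_lt_ncard ⟨fun k hk => Relation.ReflTransGen.trans hk hxy, fun hsub => hne ?_⟩
      (ht.finite_le hy)
    exact ht.antisymm _ _ hxy (hsub (show y ∈ {k | t.Le k y} from .refl))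
  -- A release that precedes an acquisition in locking order ends a strictly smaller section.
  have pred : ∀ {m l : Node L}, t.locks a m l → ¬ (m ∈ t.nodes ∧ m.IsZero) →
      ∃ k mk, t.Releases a k m ∧ t.locks a mk k ∧
        {x | t.Le x k}.ncard < {x | t.Le x l}.ncard := by
    intro m l hm hz
    obtain ⟨hu | hz', hl⟩ := ht.lock_mem _ _ _ hm
    · obtain ⟨r, hr⟩ := hu
      obtain ⟨k, hk⟩ := mem_lockset_iff.1 (hd.unlock hr)
      have hrel : t.Releases a k m := ⟨r, hr, hk⟩
      obtain ⟨mk, hmk, -⟩ := ht.lock_unique a k hk.isLock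
      refine ⟨k, mk, hrel, hmk, rank_lt ((hrel.le ht).trans (IsLock.le_of_locks hm)) ?_
        (hl.mem ht)⟩
      rintro rfl
      have := ht.antisymm _ _ (hrel.le ht) (IsLock.le_of_locks hm)
      have := hrel.idx_lt ht
      subst m
      omega
    · exact absurd hz' hz
  have main : ∀ N : ℕ, ∀ {l l' m m' : Node L},
      {k | t.Le k l}.ncard + {k | t.Le k l'}.ncard ≤ N → l ≠ l' → t.locks a m l → t.locks a m' l' →
      (∃ u, t.Releases a l u ∧ t.Le u m') ∨ (∃ u, t.Releases a l' u ∧ t.Le u m) := by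
    intro N
    induction N with
    | zero =>
      intro l l' m m' hN _ hm _
      have hl := ((ht.lock_mem _ _ _ hm).2).mem ht
      have := (Set.ncard_pos (ht.finite_le hl)).2 ⟨l, .refl⟩
      omega
    | succ N ih =>
      intro l l' m m' hN hne hm hm'
      have hmm : m ≠ m' := by
        rintro rfl
        exact hne (ht.lock_inj _ _ _ _ hm hm')
      -- The section that ends at `m'` is compared with the one entered at `l`.
      have right : ¬ (m' ∈ t.nodes ∧ m'.IsZero) → (∃ u, t.Releases a l u ∧ t.Le u m') ∨
          t.Le m' m := by
        intro hz'
        obtain ⟨k', mk', hrel', hmk', hlt'⟩ := pred hm' hz'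
        by_cases hlk : l = k'
        · subst hlk
          exact .inl ⟨m', hrel', .refl⟩
        · rcases ih (by omega) hlk hm hmk' with ⟨u, hu, hle⟩ | ⟨u, hu, hle⟩
          · exact .inl ⟨u, hu, hle.trans ((IsLock.le_of_locks hmk').trans (hrel'.le ht))⟩
          · rw [hu.unique ht hrel'] at hle
            exact .inr hle
      have left : ¬ (m ∈ t.nodes ∧ m.IsZero) → (∃ u, t.Releases a l' u ∧ t.Le u m) ∨
          t.Le m m' := by
        intro hz
        obtain ⟨k, mk, hrel, hmk, hlt⟩ := pred hm hz
        by_cases hlk : k = l'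
        · subst hlk
          exact .inl ⟨m, hrel, .refl⟩
        · rcases ih (by omega) hlk hmk hm' with ⟨u, hu, hle⟩ | ⟨u, hu, hle⟩
          · rw [hu.unique ht hrel] at hle
            exact .inr hle
          · exact .inl ⟨u, hu, hle.trans ((IsLock.le_of_locks hmk).trans (hrel.le ht))⟩
      have mem : ∀ {m l}, t.locks a m l → m ∈ t.nodes := fun h =>
        (ht.mem_of_prec (.inr (.inr (.inr ⟨a, h⟩)))).1
      by_cases hz : m ∈ t.nodes ∧ m.IsZero
      · by_cases hz' : m' ∈ t.nodes ∧ m'.IsZero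
        · exact absurd (ht.node_unique _ hz.1 _ hz'.1 (hz.2.2.trans hz'.2.2.symm)
            (hz.2.1.trans hz'.2.1.symm)) hmm
        · refine (right hz').imp_right fun hle => absurd ?_ hmm.symm
          exact ht.eq_of_le_isZero hz.1 hz.2 hle (mem hm')
      · by_cases hz' : m' ∈ t.nodes ∧ m'.IsZero
        · rcases left hz with h | hle
          · exact .inr h
          · exact absurd (ht.eq_of_le_isZero hz'.1 hz'.2 hle (mem hm)) hmm
        · rcases right hz' with h | hle
          · exact .inl h
          · rcases left hz with h | hle'
            · exact .inr h
            · exact absurd (ht.antisymm _ _ hle' hle) hmm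
  intro l l' m m' hne hm hm'
  exact main _ le_rfl hne hm hm'

/-- A thread that holds a mutex `a` protecting `g` knows all writes to `g`: if `a` is held at `z`,
and after `z` its thread neither releases `a` nor writes `g`, then all writes to `g` precede `z`. -/
theorem Disciplined.write_le_of_holds (hd : t.Disciplined prot) (ht : t.IsLocal P) {τ : L.Ty}
    {g : L.G τ} {a : L.M} (ha : a ∈ prot ⟨τ, g⟩) {z : Node L} (hz : z ∈ t.nodes)
    (hmem : a ∈ t.lockset z)
    (hlater : ∀ m act n, (m, act, n) ∈ t.edges → n.tid = z.tid → z.idx < n.idx →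
      act ≠ .unlock a ∧ ∀ y, act ≠ .write g y)
    {p q : Node L} {y : L.X τ} (he : (p, .write g y, q) ∈ t.edges) : t.Le q z := by
  obtain ⟨l, hl⟩ := mem_lockset_iff.1 hmem
  obtain ⟨l', hl'⟩ := mem_lockset_iff.1 (hd.write he ha)
  obtain ⟨-, hq, hi, htid, -⟩ := ht.edge_step _ _ _ he
  obtain ⟨m, hm, -⟩ := ht.lock_unique a l hl.isLock
  obtain ⟨m', hm', -⟩ := ht.lock_unique a l' hl'.isLock
  by_cases hne : l = l'
  · subst hne
    have hqz : q.tid = z.tid := by rw [htid, ← hl'.tid, hl.tid]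
    refine ht.le_of_idx_le hq hz hqz (not_lt.1 fun hlt => ?_)
    exact (hlater _ _ _ he hqz hlt).2 y rfl
  · rcases hd.releases_or_releases ht hne hm hm' with ⟨u, hu, -⟩ | ⟨u, hu, hle⟩
    · -- The section in which `z` lies is not left, as the release would come after `z`.
      have := hu.idx_succ_le ht hl
      have huz := (hu.tid_eq ht).symm.trans hl.tid
      obtain ⟨r, hr, -⟩ := hu
      exact absurd rfl (hlater _ _ _ hr huz (by omega)).1
    · have := hu.idx_succ_le ht hl'
      have hqu : t.Le q u := ht.le_of_idx_le hq (hu.mem ht)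
        (by rw [htid, ← hl'.tid, hu.tid_eq ht]) (by omega)
      exact hqu.trans (hle.trans ((IsLock.le_of_locks hm).trans
        (ht.le_of_idx_le (hl.isLock.mem ht) hz hl.tid hl.idx)))

/-- If the last action acquires `a`, then all writes to globals protected by `a` precede the
matching release of `a`. -/
theorem Disciplined.write_le_of_locks_sink (hd : t.Disciplined prot) (ht : t.IsLocal P) {τ : L.Ty}
    {g : L.G τ} {a : L.M} (ha : a ∈ prot ⟨τ, g⟩) {m : Node L} (hm : t.locks a m t.sink)
    {p q : Node L} {y : L.X τ} (he : (p, .write g y, q) ∈ t.edges) : t.Le q m := by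
  obtain ⟨l, hl⟩ := mem_lockset_iff.1 (hd.write he ha)
  obtain ⟨hp, hq, hi, htid, -⟩ := ht.edge_step _ _ _ he
  obtain ⟨m', hm', -⟩ := ht.lock_unique a l hl.isLock
  by_cases hne : l = t.sink
  · -- Then `p` would follow the sink in its thread.
    subst hne
    have := ht.antisymm _ _ (ht.le_sink p hp) (ht.le_of_idx_le ht.sink_mem hp hl.tid hl.idx)
    subst this
    exact absurd he ht.not_edge_sink
  · rcases hd.releases_or_releases ht hne hm' hm with ⟨u, hu, hle⟩ | ⟨u, hu, -⟩
    · have := hu.idx_succ_le ht hl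
      exact (ht.le_of_idx_le hq (hu.mem ht) (by rw [htid, ← hl.tid, hu.tid_eq ht])
        (by omega)).trans hle
    · have h₁ := hu.idx_lt ht
      have h₂ := ht.antisymm _ _ (hu.le ht) (ht.le_sink u (hu.mem ht))
      subst h₂
      omega

end Trace

/-! ### Start traces of created threads -/

namespace Trace

variable {L : Lang.{u}} {P : Prog L} {t : Trace L}

theorem IsLocal.not_prec_self (ht : t.IsLocal P) (m : Node L) : ¬ t.Prec m m := by
  rintro (⟨act, h⟩ | h | h | ⟨a, h⟩)
  · have := (ht.edge_step _ _ _ h).2.2.1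
    omega
  · -- A self-loop in create order would be the only step into `m`, so `m` would be unreachable.
    obtain ⟨hm, -, hi, hz, -⟩ := ht.create_mem _ _ h
    obtain ⟨z, -, hzero, -, hle⟩ := ht.least
    have key : ∀ k, t.Prec k m → k = m := by
      rintro k (⟨act, hk⟩ | hk | hk | ⟨a, hk⟩)
      · have := (ht.edge_step _ _ _ hk).2.2.1
        omega
      · exact (ht.create_unique m hm hi hz).unique hk h
      · obtain ⟨k', x, x', he⟩ := (ht.join_mem _ _ hk).2
        have := (ht.edge_step _ _ _ he).2.2.1
        omega
      · obtain ⟨k', he⟩ := (ht.lock_mem _ _ _ hk).2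
        have := (ht.edge_step _ _ _ he).2.2.1
        omega
    have : ∀ k, t.Le k m → k = m := by
      intro k hk
      induction hk using Relation.ReflTransGen.head_induction_on with
      | refl => rfl
      | head hk _ ih => subst ih; exact key _ hk
    exact hz (this z (hle m hm) ▸ hzero)
  · obtain ⟨⟨r, x, hr⟩, ⟨r', x₁, x₂, hj⟩⟩ := ht.join_mem _ _ h
    have := (ht.edge_unique _ _ _ _ _ hr hj).2
    cases this
  · obtain ⟨⟨r, hr⟩ | hz, ⟨r', hl⟩⟩ := ht.lock_mem _ _ _ h
    · have := (ht.edge_unique _ _ _ _ _ hr hl).2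
      cases this
    · have := (ht.edge_step _ _ _ hl).2.2.1
      have := hz.2.1
      omega

theorem IsLocal.not_creates_sink (ht : t.IsLocal P) (s : Node L) : ¬ t.creates t.sink s := by
  intro h
  have := ht.antisymm _ _ (.single (.inr (.inl h))) (ht.le_sink s (ht.create_mem _ _ h).2.1)
  subst this
  exact ht.not_prec_self _ (.inr (.inl h))

/-- If the sink of `t` can execute a create action that yields the id `i`, then the start of the
new thread with id `i` is also a local trace. -/
theorem IsLocal.spawn (ht : t.IsLocal P) {x : L.X L.tid} {u₁ u' : L.N} {σ : LState L}
    {i : L.Val L.tid} (hP : P.edge t.sink.pt (.create x u₁) u')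
    (he : (t.extend (.create x u₁) ⟨t.sink.idx + 1, u', σ⟩).IsLocal P)
    (hi : σ ⟨L.tid, x⟩ = i) :
    (t.spawn ⟨0, u₁, Function.update t.sink.σ ⟨L.tid, L.self⟩ i⟩).IsLocal P := by
  set n : Node L := ⟨0, u₁, Function.update t.sink.σ ⟨L.tid, L.self⟩ i⟩ with hn
  have hntid : n.tid = i := by simp [hn, Node.tid]
  have halloc : (t.extend (.create x u₁) ⟨t.sink.idx + 1, u', σ⟩).Allocates t.sink i :=
    .inl ⟨x, u₁, _, .inl rfl, hi⟩
  have hi0 : i ≠ L.zero L.tid := he.fresh_zero _ _ halloc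
  have hnz : ¬ n.IsZero := fun h => hi0 (hntid.symm.trans h.2)
  -- The thread `i` does not occur in `t`.
  have hfresh : ∀ m ∈ t.nodes, m.idx = 0 → m.tid ≠ i := by
    intro m hm hm0 hmi
    obtain ⟨z, hz, -⟩ := ht.create_unique m hm hm0 fun h => hi0 (hmi.symm.trans h.2)
    have := he.fresh _ _ _ halloc (.inr ⟨m, hz, hmi⟩)
    subst this
    exact ht.not_creates_sink _ hz
  have hnt : n ∉ t.nodes := fun h => hfresh n h rfl hntid
  have hprec : ∀ {a b}, (t.spawn n).Prec a b → t.Prec a b ∨ (a = t.sink ∧ b = n) := by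
    rintro a b (h | (h | h) | h | h)
    · exact .inl (.inl h)
    · exact .inl (.inr (.inl h))
    · exact .inr h
    · exact .inl (.inr (.inr (.inl h)))
    · exact .inl (.inr (.inr (.inr h)))
  have hmax : ∀ {k}, (t.spawn n).Le n k → k = n := by
    intro k h
    rcases Relation.ReflTransGen.cases_head h with h | ⟨b, h, -⟩
    · exact h.symm
    · rcases hprec h with h | ⟨h, -⟩
      · exact absurd (ht.mem_of_prec h).1 hnt
      · exact absurd (h ▸ ht.sink_mem) hnt
  have hle : ∀ {a b}, (t.spawn n).Le a b → b ≠ n → t.Le a b := by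
    intro a b h
    induction h with
    | refl => exact fun _ => .refl
    | tail _ h ih =>
      intro hb
      rcases hprec h with h | ⟨-, h⟩
      · exact (ih fun h' => hnt (h' ▸ (ht.mem_of_prec h).1)).tail h
      · exact absurd h hb
  have hle' : ∀ {a b}, t.Le a b → (t.spawn n).Le a b := fun h => (t.sub_spawn n).le h
  have hsink : (t.spawn n).Le t.sink n := .single (.inr (.inl (.inr ⟨rfl, rfl⟩)))
  have hedge : ∀ {a act b}, (a, act, b) ∈ t.edges → a ≠ n ∧ b ≠ n := by
    intro a act b h
    obtain ⟨h₁, h₂, -⟩ := ht.edge_step _ _ _ h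
    exact ⟨fun h' => hnt (h' ▸ h₁), fun h' => hnt (h' ▸ h₂)⟩
  have hallocs : ∀ {z j}, (t.spawn n).Allocates z j →
      (t.extend (.create x u₁) ⟨t.sink.idx + 1, u', σ⟩).Allocates z j := by
    rintro z j (⟨y, v, z', h, hj⟩ | ⟨s, h | ⟨rfl, rfl⟩, hs⟩)
    · exact .inl ⟨y, v, z', .inr h, hj⟩
    · exact .inr ⟨s, h, hs⟩
    · rw [← hs, hntid]
      exact halloc
  have hwrite : ∀ {τ : L.Ty} {z : Node L} {g : L.G τ} {p q y}, z ≠ n →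
      t.IsLastWrite z g p y q → (t.spawn n).IsLastWrite z g p y q := by
    rintro τ z g p q y hz ⟨h₁, h₂, h₃⟩
    exact ⟨h₁, hle' h₂, fun p' y' q' he' hq' => hle' (h₃ p' y' q' he' (hle hq' hz))⟩
  refine
    { finite := ht.finite.insert _
      node_unique := ?_
      edge_unique := ht.edge_unique
      edge_exists := ?_
      edge_step := fun m act k h => ?_
      antisymm := fun a b hab hba => ?_
      least := ?_
      create_mem := ?_
      create_unique := ?_
      create_inj := ?_
      create_state := ?_
      create_edge := ?_
      fresh_zero := fun z j h => he.fresh_zero z j (hallocs h)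
      fresh := fun z z' j h h' => he.fresh z z' j (hallocs h) (hallocs h')
      join_mem := ht.join_mem
      join_unique := ht.join_unique
      join_inj := ht.join_inj
      join_value := ht.join_value
      lock_mem := fun a m k h => ?_
      lock_unique := ht.lock_unique
      lock_inj := ht.lock_inj
      read_value := fun τ z z' y g h => ?_
      sink_mem := .inl rfl
      le_sink := ?_ }
  · rintro a (rfl | ha) b (rfl | hb) htid hidx
    · rfl
    · exact absurd (htid.symm.trans hntid) (hfresh b hb hidx.symm)
    · exact absurd (htid.trans hntid) (hfresh a ha hidx)
    · exact ht.node_unique a ha b hb htid hidx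
  · rintro a (rfl | ha) h
    · exact absurd rfl h
    · exact ht.edge_exists a ha h
  · obtain ⟨h₁, h₂, h₃⟩ := ht.edge_step _ _ _ h
    exact ⟨.inr h₁, .inr h₂, h₃⟩
  · by_cases hb : b = n
    · subst hb
      exact hmax hba
    · by_cases ha : a = n
      · subst ha
        exact (hmax hab).symm
      · exact ht.antisymm _ _ (hle hab hb) (hle hba ha)
  · obtain ⟨z, hz, hzero, hpt, hmin⟩ := ht.least
    refine ⟨z, .inr hz, hzero, hpt, ?_⟩
    rintro k (rfl | hk)
    · exact (hle' (hmin _ ht.sink_mem)).trans hsink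
    · exact hle' (hmin k hk)
  · rintro z s (h | ⟨rfl, rfl⟩)
    · obtain ⟨h₁, h₂, h₃⟩ := ht.create_mem _ _ h
      exact ⟨.inr h₁, .inr h₂, h₃⟩
    · exact ⟨.inr ht.sink_mem, .inl rfl, rfl, hnz, x, u', hP⟩
  · rintro s (rfl | hs) h0 hz
    · refine ⟨t.sink, .inr ⟨rfl, rfl⟩, ?_⟩
      rintro z (h | ⟨rfl, -⟩)
      · exact absurd (ht.create_mem _ _ h).2.1 hnt
      · rfl
    · obtain ⟨z, hz', huniq⟩ := ht.create_unique s hs h0 hz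
      refine ⟨z, .inl hz', ?_⟩
      rintro z' (h | ⟨-, rfl⟩)
      · exact huniq _ h
      · exact absurd hs hnt
  · rintro z s s' (h | ⟨rfl, rfl⟩) (h' | ⟨h', rfl⟩)
    · exact ht.create_inj _ _ _ h h'
    · exact absurd (h' ▸ h) (ht.not_creates_sink _)
    · exact absurd h' (ht.not_creates_sink _)
    · rfl
  · rintro z s (h | ⟨rfl, rfl⟩)
    · exact ht.create_state _ _ h
    · rw [hntid]
  · rintro z s act z' (h | ⟨rfl, rfl⟩) h'
    · exact ht.create_edge _ _ _ _ h h'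
    · exact absurd h' ht.not_edge_sink
  · obtain ⟨h₁, h₂⟩ := ht.lock_mem _ _ _ h
    exact ⟨h₁.imp_right fun h => ⟨.inr h.1, h.2⟩, h₂⟩
  · rcases ht.read_value τ z z' y g h with ⟨p, w, q, hl, hv⟩ | ⟨hl, hv⟩
    · exact .inl ⟨p, w, q, hwrite (hedge h).1 hl, hv⟩
    · exact .inr ⟨fun p w q h' hq => hl p w q h' (hle hq (hedge h).1), hv⟩
  · rintro k (rfl | hk)
    · exact .refl
    · exact (hle' (ht.le_sink k hk)).trans hsink

end Trace

/-! ### Stores and abstract operations -/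

section Domain

variable {L : Lang.{u}} {A : L.Ty → Type v} [∀ τ, CompleteLattice (A τ)]
  {V : ValueDomain L A} {R : Type w} [CompleteLattice R] {D : RelationalDomain L A V R}

theorem Store.locals_update_loc (σ : Store L) {τ : L.Ty} (x : L.X τ) (c : L.Val τ) :
    Store.locals (Function.update σ ⟨τ, .loc x⟩ c) = Function.update σ.locals ⟨τ, x⟩ c := by
  funext y
  by_cases hy : y = ⟨τ, x⟩
  · subst hy
    simp [Store.locals]
  · have : (⟨y.1, .loc y.2⟩ : Vars L) ≠ ⟨τ, .loc x⟩ := by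
      rintro h
      obtain ⟨τ', y⟩ := y
      simp only [Sigma.mk.injEq] at h
      obtain ⟨rfl, h⟩ := h
      simp at h
      exact hy (by rw [h])
    rw [Function.update_of_ne hy, Store.locals, Function.update_of_ne this]
    rfl

theorem Store.locals_update_glob (σ : Store L) {τ : L.Ty} (g : L.G τ) (c : L.Val τ) :
    Store.locals (Function.update σ ⟨τ, .glob g⟩ c) = σ.locals := by
  funext y
  have : (⟨y.1, .loc y.2⟩ : Vars L) ≠ ⟨τ, .glob g⟩ := by
    rintro h
    obtain ⟨τ', y⟩ := y
    simp only [Sigma.mk.injEq] at h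
    obtain ⟨rfl, h⟩ := h
    simp at h
  rw [Store.locals, Function.update_of_ne this]
  rfl

theorem glob_ne_loc {τ : L.Ty} (x : L.X τ) (g : Glob L) :
    (⟨g.1, .glob g.2⟩ : Vars L) ≠ ⟨τ, .loc x⟩ := by
  rintro h
  obtain ⟨τ', g⟩ := g
  simp only [Sigma.mk.injEq] at h
  obtain ⟨rfl, h⟩ := h
  simp at h

theorem glob_ne_glob {g g' : Glob L} (h : g ≠ g') :
    (⟨g.1, .glob g.2⟩ : Vars L) ≠ ⟨g'.1, .glob g'.2⟩ := by
  rintro h'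
  obtain ⟨τ, g⟩ := g
  obtain ⟨τ', g'⟩ := g'
  simp only [Sigma.mk.injEq] at h'
  obtain ⟨rfl, h'⟩ := h'
  simp at h'
  exact h (by rw [h'])

/-- Undoing an update of a local variable in a store. -/
theorem Store.exists_update_eq {σ : Store L} {s : LState L} {τ : L.Ty} {x : L.X τ} {c : L.Val τ}
    (h : σ.locals = Function.update s ⟨τ, x⟩ c) :
    ∃ ρ : Store L, ρ.locals = s ∧ (∀ g : Glob L, ρ ⟨g.1, .glob g.2⟩ = σ ⟨g.1, .glob g.2⟩) ∧
      σ = Function.update ρ ⟨τ, .loc x⟩ c := by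
  refine ⟨Function.update σ ⟨τ, .loc x⟩ (s ⟨τ, x⟩), ?_, fun g => ?_, ?_⟩
  · rw [Store.locals_update_loc, h, Function.update_idem, Function.update_eq_self]
  · rw [Function.update_of_ne (glob_ne_loc x g)]
  · have : c = σ ⟨τ, .loc x⟩ := by simpa [Store.locals] using (congrFun h ⟨τ, x⟩).symm
    rw [Function.update_idem, this, Function.update_eq_self]

theorem ValueDomain.ne_bot (V : ValueDomain L A) {τ : L.Ty} {a : A τ} {c : L.Val τ}
    (h : c ∈ V.γ a) : a ≠ ⊥ := by
  rintro rfl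
  rw [V.γ_bot] at h
  exact h

theorem ValueDomain.mem_γ_topUpdate (V : ValueDomain L A) {y : Vars L} {a : A y.1} {σ : Store L}
    (h : σ y ∈ V.γ a) (z : Vars L) : σ z ∈ V.γ ((AbsAssign.topUpdate y a).val z) := by
  have key : ∀ z, σ z ∈ V.γ (Function.update (fun z : Vars L => (⊤ : A z.1)) y a z) := by
    intro z
    by_cases hz : z = y
    · subst hz
      rwa [Function.update_self]
    · rw [Function.update_of_ne hz, V.γ_top]
      trivial
  rw [AbsAssign.topUpdate, dif_pos fun z => V.ne_bot (key z)]
  exact key z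

theorem RelationalDomain.mem_γ_top (D : RelationalDomain L A V R) (σ : Store L) : σ ∈ D.γ ⊤ :=
  D.γ_mono le_top (D.γ_lift _ σ (V.mem_γ_topUpdate (y := selfVar L) (a := ⊤)
    (by rw [V.γ_top]; trivial)))

theorem RelationalDomain.ne_bot (D : RelationalDomain L A V R) {r : R} {σ : Store L}
    (h : σ ∈ D.γ r) : r ≠ ⊥ := by
  rintro rfl
  rw [D.γ_bot] at h
  exact h

theorem RelationalDomain.mem_γ_assignAbs (D : RelationalDomain L A V R) {y : Vars L} {a : A y.1}
    {r : R} {σ : Store L} (h : σ ∈ D.γ r) {c : L.Val y.1} (hc : c ∈ V.γ a) :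
    Function.update σ y c ∈ D.γ (D.assignAbs y a r) := by
  refine D.γ_inf _ _ ⟨D.γ_restr _ _ σ h _ fun z hz => Function.update_of_ne hz _ _, ?_⟩
  exact D.γ_lift _ _ (V.mem_γ_topUpdate (by rwa [Function.update_self]))

theorem RelationalDomain.mem_γ_assignZeros (D : RelationalDomain L A V R) {σ : Store L}
    {l : List (Glob L)} (hl : ∀ g ∈ l, σ ⟨g.1, .glob g.2⟩ = L.zero g.1) {r : R} (h : σ ∈ D.γ r) :
    σ ∈ D.γ (D.assignZeros l r) := by
  induction l generalizing r with
  | nil => exact h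
  | cons g l ih =>
    refine ih (fun g' hg' => hl g' (List.mem_cons_of_mem _ hg')) ?_
    have := D.γ_assign (.glob g.2) .zero r σ h
    have hg : RExpr.eval σ .zero = σ ⟨g.1, .glob g.2⟩ := (hl g List.mem_cons_self).symm
    rwa [hg, Function.update_eq_self] at this

theorem RelationalDomain.mem_γ_biInf (D : RelationalDomain L A V R) {ι : Type*} (s : Finset ι)
    (f : ι → R) {σ : Store L} (h : ∀ i ∈ s, σ ∈ D.γ (f i)) : σ ∈ D.γ (⨅ i ∈ s, f i) := by
  rw [← Finset.inf_eq_iInf]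
  exact Finset.inf_induction (p := fun r => σ ∈ D.γ r) (D.mem_γ_top σ)
    (fun _ h₁ _ h₂ => D.γ_inf _ _ ⟨h₁, h₂⟩) h

end Domain

/-! ### Values of globals under extension of traces -/

namespace Trace

variable {L : Lang.{u}} {P : Prog L} {t s : Trace L}

theorem last_extend (act : Act L) (n : Node L) : (t.extend act n).Last act := ⟨_, .inl rfl⟩

theorem lastValue_extend {act : Act L} {n : Node L} (ht : t.IsLocal P)
    (ht' : (t.extend act n).IsLocal P) {g : Glob L} (h : ∀ y, act ≠ .write g.2 y) :
    (t.extend act n).lastValue g = t.lastValue g := by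
  refine (t.sub_extend act n).lastValue_eq ht ht' ?_
  rintro p y q (he | he)
  · cases he
    exact absurd rfl (h y)
  · exact (ht.edge_step _ _ _ he).2.1

theorem lastValue_extend_write {τ : L.Ty} {g : L.G τ} {x : L.X τ} {n : Node L}
    (ht' : (t.extend (.write g x) n).IsLocal P) :
    (t.extend (.write g x) n).lastValue ⟨τ, g⟩ = t.sink.σ ⟨τ, x⟩ :=
  lastValue_of_isLastWrite (p := t.sink) (q := n) ht' ⟨.inl rfl, .refl, fun _ _ _ _ h => h⟩

/-- The value read for a global is its last value in the trace up to the read. -/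
theorem read_eq_lastValue {τ : L.Ty} {g : L.G τ} {x : L.X τ} {n : Node L} (ht : t.IsLocal P)
    (ht' : (t.extend (.read x g) n).IsLocal P) : n.σ ⟨τ, x⟩ = t.lastValue ⟨τ, g⟩ := by
  have hsub := t.sub_extend (.read x g) n
  have hedge : ∀ {p y q}, (p, .write g y, q) ∈ (t.extend (.read x g) n).edges →
      (p, .write g y, q) ∈ t.edges := by
    rintro p y q (he | he)
    · cases he
    · exact he
  rcases ht'.read_value τ t.sink n x g (.inl rfl) with ⟨p, y, q, ⟨he, -, hl⟩, hv⟩ | ⟨hl, hv⟩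
  · have hq := (ht.edge_step _ _ _ (hedge he)).2.1
    refine hv.trans (lastValue_of_isLastWrite ht ⟨hedge he, ht.le_sink q hq, ?_⟩).symm
    intro p' y' q' he' hle
    exact (hsub.le_of_mem ht ht' hq (hl p' y' q' (hsub.edges he') (hsub.le hle))).1
  · refine hv.trans (lastValue_of_no_write fun p y q he => ?_).symm
    exact hl p y q (hsub.edges he) (hsub.le (ht.le_sink q (ht.edge_step _ _ _ he).2.1))

/-- When another trace is incorporated, the globals protected by the mutexes held by the ego thread
keep their values: mutual exclusion rules out writes that are unknown to the ego thread. -/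
theorem lastValue_eq_of_lockset {prot : Glob L → Set L.M} (hs : s.IsLocal P) (ht : t.IsLocal P)
    (hd : t.Disciplined prot) (hsub : s.Sub t) {act : Act L}
    (he : (s.sink, act, t.sink) ∈ t.edges) (hu : ∀ a, act ≠ .unlock a) {g : Glob L}
    (hw : ∀ y, act ≠ .write g.2 y) {a : L.M} (ha : a ∈ s.lockset s.sink) (hg : a ∈ prot g) :
    t.lastValue g = s.lastValue g := by
  refine hsub.lastValue_eq hs ht fun p y q hpq => ?_
  refine (hsub.le_of_mem hs ht hs.sink_mem
    (hd.write_le_of_holds ht hg (hsub.nodes hs.sink_mem) ?_ ?_ hpq)).2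
  · rwa [hsub.lockset_eq hs ht hs.sink_mem]
  · -- The only action of the ego thread after the sink of `s` is `act`.
    intro m act' n hmn htid hidx
    obtain ⟨-, hn, -⟩ := ht.edge_step _ _ _ hmn
    obtain ⟨-, -, hi, htid', -⟩ := ht.edge_step _ _ _ he
    have hle := ht.idx_le_of_le hn ht.sink_mem (htid.trans htid'.symm) (ht.le_sink n hn)
    obtain rfl := ht.node_unique n hn _ ht.sink_mem (htid.trans htid'.symm) (by omega)
    obtain ⟨-, rfl⟩ := ht.edge_unique _ _ _ _ _ hmn he
    exact ⟨hu a, hw⟩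

/-- When a mutex `a` is acquired, the globals protected by `a` have the values they had when `a`
was last released. -/
theorem lastValue_eq_of_locks {prot : Glob L → Set L.M} (hs : s.IsLocal P) (ht : t.IsLocal P)
    (hd : t.Disciplined prot) (hsub : s.Sub t) {a : L.M} (h : t.locks a s.sink t.sink) {g : Glob L}
    (hg : a ∈ prot g) : t.lastValue g = s.lastValue g :=
  hsub.lastValue_eq hs ht fun _ _ _ hpq =>
    (hsub.le_of_mem hs ht hs.sink_mem (hd.write_le_of_locks_sink ht hg h hpq)).2

theorem lockset_eq_empty (ht : t.IsLocal P) {z : Node L} (h : z.idx = 0) : t.lockset z = ∅ := by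
  refine Set.eq_empty_of_forall_notMem ?_
  rintro a ⟨m, n, he, -, hle, -⟩
  have := (ht.edge_step _ _ _ he).2.2.1
  omega

end Trace

/-! ### Soundness -/

section Soundness

variable {L : Lang.{u}} {P : Prog L} {A : L.Ty → Type v} [∀ τ, CompleteLattice (A τ)]
  {V : ValueDomain L A} {R : Type w} [CompleteLattice R] {D : RelationalDomain L A V R}
  {B : Params L A R} {η : AUnknown L A → R}

/-- The invariant at program points: `r` contains all stores that agree with `t` on the locals, on
the globals protected by the mutexes in `S`, and on the global accessed by the last action (if any).
The values of all other globals are left open since other threads may change them. -/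
def CoversPoint (D : RelationalDomain L A V R) (B : Params L A R) (S : Set L.M) (r : R)
    (t : Trace L) : Prop :=
  ∀ σ : Store L, σ.locals = t.sink.σ →
    (∀ g, g ∈ B.protectedBy S ∨ (∃ act, t.Last act ∧ act.Accesses g) →
      σ ⟨g.1, .glob g.2⟩ = t.lastValue g) → σ ∈ D.γ r

/-- The invariant for mutexes and clusters: `r` contains all stores that agree with `t` on `Q`. -/
def CoversCluster (D : RelationalDomain L A V R) (Q : Finset (Glob L)) (r : R) (t : Trace L) :
    Prop :=
  ∀ σ : Store L, (∀ g ∈ Q, σ ⟨g.1, .glob g.2⟩ = t.lastValue g) → σ ∈ D.γ r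

/-- The strengthened soundness claim for the trace `t` in the value of a concrete unknown. -/
def Covers (P : Prog L) (D : RelationalDomain L A V R) (B : Params L A R) (η : AUnknown L A → R) :
    CUnknown L → Trace L → Prop
  | .point p, t => CoversPoint D B (t.lockset t.sink) (η (.point p (t.lockset t.sink))) t
  | .mutex a, t => (t.Last (.unlock a) ∨ t ∈ initTraces P) ∧
      ∀ Q ∈ B.clusters a, CoversCluster D Q (η (.cluster a Q)) t
  | .thread i, t => t.sink.tid = i ∧ ∃ x j, t.Last (.ret x) ∧ i ∈ V.γ j ∧
      t.store (t.sink.σ ⟨L.rty, x⟩) ∈ D.γ (η (.thread j))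

theorem CoversPoint.store_mem {S : Set L.M} {r : R} {t : Trace L} (h : CoversPoint D B S r t)
    (c : L.Val L.rty) : t.store c ∈ D.γ r :=
  h _ rfl fun _ _ => rfl

/-- Only `unlock` can follow an access to a global, so before any other action the invariant says
nothing about unprotected globals. -/
theorem CoversPoint.mem_of_ne_unlock (hatomic : P.AtomicAccess) {S : Set L.M} {r : R} {t : Trace L}
    (h : CoversPoint D B S r t) (ht : t.IsLocal P) {act : Act L} {q : L.N}
    (e : P.edge t.sink.pt act q) (hact : ∀ a, act ≠ .unlock a) {σ : Store L}
    (hσ : σ.locals = t.sink.σ)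
    (hg : ∀ g, g ∈ B.protectedBy S → σ ⟨g.1, .glob g.2⟩ = t.lastValue g) : σ ∈ D.γ r := by
  refine h σ hσ fun g hg' => ?_
  rcases hg' with hg' | ⟨act', ⟨m, hm⟩, hacc⟩
  · exact hg g hg'
  · exact absurd (hatomic.unlock_after (ht.edge_step _ _ _ hm).2.2.2.2.1 hacc e) (hact _)

theorem IsAbstractSolution.edge_le (hη : IsAbstractSolution D B P η) {p q : L.N} {act : Act L}
    {S : Set L.M} (e : P.edge p act q) (h : η (.point p S) ≠ ⊥) :
    (absRhsNonBot D B p S act η (η (.point p S))).2 ≤ η (.point q (act.locksetAfter S)) := by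
  have := hη.edge p act q S e
  rwa [absRhs, if_neg h] at this

theorem IsAbstractSolution.edge_side_le (hη : IsAbstractSolution D B P η) {p q : L.N} {act : Act L}
    {S : Set L.M} (e : P.edge p act q) (h : η (.point p S) ≠ ⊥) (k : AUnknown L A) :
    (absRhsNonBot D B p S act η (η (.point p S))).1 k ≤ η k := by
  have := hη.edge_side p act q S e
  rw [absRhs, if_neg h] at this
  exact this k

theorem covers_init (hmain : L.zero L.tid ∈ V.γ B.i₀) (hη : IsAbstractSolution D B P η)
    {t : Trace L} (ht : t ∈ initTraces P) : Covers P D B η (.point P.start) t := by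
  have hloc := isLocal_of_mem_initTraces ht
  obtain ⟨σ₀, h0, rfl⟩ := ht
  intro σ hσ _
  rw [Trace.lockset_eq_empty hloc rfl]
  refine D.γ_mono hη.init ?_
  have := D.mem_γ_assignAbs (D.mem_γ_top σ) (y := selfVar L) (c := σ (selfVar L)) (a := B.i₀) (by
    have : σ (selfVar L) = L.zero L.tid := (congrFun hσ ⟨L.tid, L.self⟩).trans h0
    rwa [this])
  rwa [Function.update_eq_self] at this

theorem covers_initMutex (hη : IsAbstractSolution D B P η) {t : Trace L} (a : L.M)
    (ht : t ∈ initTraces P) : Covers P D B η (.mutex a) t := by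
  refine ⟨.inr ht, fun Q hQ σ hσ => ?_⟩
  have hle := hη.init_side (.cluster a Q)
  simp only [initRhs, if_pos hQ] at hle
  refine D.γ_mono hle (D.mem_γ_assignZeros (fun g hg => ?_) (D.mem_γ_top σ))
  rw [hσ g ((B.mem_enum Q g).1 hg)]
  obtain ⟨σ₀, -, rfl⟩ := ht
  exact Trace.lastValue_of_no_write fun _ _ _ h => h

/-- An abstract thread id computed by `ν` describes the id that a create action yields. -/
theorem mem_γ_ν (hν : SoundNu D B P) {t : Trace L} (hc : Collects P (.point t.sink.pt) t)
    {r : R} (hr : CoversPoint D B (t.lockset t.sink) r t) {x : L.X L.tid} {u₁ q : L.N}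
    (e : P.edge t.sink.pt (.create x u₁) q) {σ : LState L}
    (ht' : (t.extend (.create x u₁) ⟨t.sink.idx + 1, q, σ⟩).IsLocal P)
    (hi : σ ⟨L.tid, x⟩ ∈ P.alloc t t.sink.pt u₁) :
    σ ⟨L.tid, x⟩ ∈ V.γ (B.ν t.sink.pt u₁ r) := by
  have := hν t.sink.pt u₁ _ r t ⟨hc.traces, rfl, rfl, L.zero _, hr.store_mem _⟩ _
    ⟨rfl, σ ⟨L.tid, x⟩, hi, rfl, hc.isLocal.spawn e ht' rfl⟩
  simpa [Trace.spawn, Node.tid] using this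

theorem covers_unary (hatomic : P.AtomicAccess) (hν : SoundNu D B P)
    (hη : IsAbstractSolution D B P η) {p q : L.N} {act : Act L} {t t' : Trace L}
    (e : P.edge p act q) (hl : ∀ a, act ≠ .lock a) (hj : ∀ x x', act ≠ .join x x')
    (hc : Collects P (.point p) t) (h : t' ∈ sem₁ P p act q t)
    (ih : Covers P D B η (.point p) t) : Covers P D B η (.point q) t' := by
  have ht := hc.isLocal
  obtain ⟨rfl, σ', rfl, ht', halloc⟩ := h
  set n : Node L := ⟨t.sink.idx + 1, q, σ'⟩ with hn
  set S := t.lockset t.sink with hS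
  set r := η (.point t.sink.pt S) with hr
  have ih : CoversPoint D B S r t := ih
  have hnewEdge : (t.sink, act, n) ∈ (t.extend act n).edges := .inl rfl
  have hstep : act.Step t.sink.σ σ' := (ht'.edge_step _ _ _ hnewEdge).2.2.2.2.2
  have hlock : (t.extend act n).lockset (t.extend act n).sink = act.locksetAfter S := by
    rw [hS, ← (t.sub_extend act n).lockset_eq ht ht' ht.sink_mem]
    exact ht'.lockset_of_edge hnewEdge
  have hle := hη.edge_le e (D.ne_bot (ih.store_mem (L.zero _)))
  show CoversPoint D B _ _ _
  rw [hlock]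
  intro σ hσ hg
  change σ.locals = σ' at hσ
  refine D.γ_mono hle ?_
  clear hle
  cases act with
  | lock a => exact absurd rfl (hl a)
  | join x x' => exact absurd rfl (hj x x')
  | unlock a =>
    have hlv : ∀ g, (t.extend (.unlock a) n).lastValue g = t.lastValue g := fun g =>
      Trace.lastValue_extend ht ht' (by simp)
    refine D.γ_restr _ _ _ (ih.store_mem (L.zero _)) σ ?_
    rintro y (⟨x, rfl⟩ | ⟨g, hgS, rfl⟩)
    · exact congrFun (hσ.trans hstep) x
    · exact (hg g (.inl hgS)).trans (hlv g)
  | read x g =>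
    have hlv : ∀ g', (t.extend (.read x g) n).lastValue g' = t.lastValue g' := fun g' =>
      Trace.lastValue_extend ht ht' (by simp)
    obtain ⟨c, rfl⟩ := hstep
    have hval : c = t.lastValue ⟨_, g⟩ := by
      simpa [hn] using Trace.read_eq_lastValue ht ht'
    obtain ⟨ρ, hρ, hρg, rfl⟩ := Store.exists_update_eq hσ
    have hmem : ρ ∈ D.γ r := ih.mem_of_ne_unlock hatomic ht e (by simp) hρ fun g' hg' => by
      rw [hρg, hg g' (.inl hg'), hlv]
    have hc : c = RExpr.eval ρ (.var (.glob g)) := by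
      have h₁ := hg ⟨_, g⟩ (.inr ⟨_, t.last_extend _ _, .read x g⟩)
      rw [hlv, ← hval, ← hρg] at h₁
      exact h₁.symm
    rw [hc]
    exact D.γ_assign _ _ _ _ hmem
  | @write τ g x =>
    have hσ : σ.locals = t.sink.σ := hσ.trans hstep
    have hmem : Function.update σ ⟨τ, .glob g⟩ (t.lastValue ⟨τ, g⟩) ∈ D.γ r := by
      refine ih.mem_of_ne_unlock hatomic ht e (by simp)
        ((Store.locals_update_glob _ _ _).trans hσ) fun g' hg' => ?_
      by_cases hgg : g' = ⟨τ, g⟩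
      · subst hgg
        exact Function.update_self _ _ _
      · rw [Function.update_of_ne (glob_ne_glob (g' := ⟨τ, g⟩) hgg), hg g' (.inl hg')]
        refine Trace.lastValue_extend ht ht' fun y h => hgg ?_
        obtain ⟨τ', g'⟩ := g'
        cases h
        rfl
    have := D.γ_assign (.glob g) (.var (.loc x)) r _ hmem
    have hx : RExpr.eval (Function.update σ ⟨τ, .glob g⟩ (t.lastValue ⟨τ, g⟩)) (.var (.loc x)) =
        σ ⟨τ, .glob g⟩ := by
      rw [hg ⟨τ, g⟩ (.inr ⟨_, t.last_extend _ _, .write g x⟩), Trace.lastValue_extend_write ht']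
      exact congrFun ((Store.locals_update_glob σ g _).trans hσ) ⟨τ, x⟩
    rwa [Function.update_idem, hx, Function.update_eq_self] at this
  | assign x ex =>
    have hlv : ∀ g', (t.extend (.assign x ex) n).lastValue g' = t.lastValue g' := fun g' =>
      Trace.lastValue_extend ht ht' (by simp)
    obtain rfl := hstep
    obtain ⟨ρ, hρ, hρg, rfl⟩ := Store.exists_update_eq hσ
    have hmem : ρ ∈ D.γ r := ih.mem_of_ne_unlock hatomic ht e (by simp) hρ fun g' hg' => by
      rw [hρg, hg g' (.inl hg'), hlv]
    rw [← hρ]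
    exact D.γ_assign _ (.expr ex) _ _ hmem
  | havoc x =>
    have hlv : ∀ g', (t.extend (.havoc x) n).lastValue g' = t.lastValue g' := fun g' =>
      Trace.lastValue_extend ht ht' (by simp)
    obtain ⟨c, rfl⟩ := hstep
    obtain ⟨ρ, hρ, hρg, rfl⟩ := Store.exists_update_eq hσ
    have hmem : ρ ∈ D.γ r := ih.mem_of_ne_unlock hatomic ht e (by simp) hρ fun g' hg' => by
      rw [hρg, hg g' (.inl hg'), hlv]
    exact D.γ_restr _ _ _ hmem _ fun y hy => Function.update_of_ne hy _ _
  | guard cond =>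
    have hlv : ∀ g', (t.extend (.guard cond) n).lastValue g' = t.lastValue g' := fun g' =>
      Trace.lastValue_extend ht ht' (by simp)
    obtain ⟨hcond, rfl⟩ := hstep
    refine D.γ_guard _ _ _ (ih.mem_of_ne_unlock hatomic ht e (by simp) hσ fun g' hg' => ?_) ?_
    · rw [hg g' (.inl hg'), hlv]
    · rwa [hσ]
  | create x u₁ =>
    have hlv : ∀ g', (t.extend (.create x u₁) n).lastValue g' = t.lastValue g' := fun g' =>
      Trace.lastValue_extend ht ht' (by simp)
    have hi := mem_γ_ν hν hc ih e ht' (halloc x u₁ rfl)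
    obtain ⟨c, rfl⟩ := hstep
    rw [Function.update_self] at hi
    obtain ⟨ρ, hρ, hρg, rfl⟩ := Store.exists_update_eq hσ
    have hmem : ρ ∈ D.γ r := ih.mem_of_ne_unlock hatomic ht e (by simp) hρ fun g' hg' => by
      rw [hρg, hg g' (.inl hg'), hlv]
    exact D.mem_γ_assignAbs hmem hi
  | ret x =>
    have hlv : ∀ g', (t.extend (.ret x) n).lastValue g' = t.lastValue g' := fun g' =>
      Trace.lastValue_extend ht ht' (by simp)
    refine ih.mem_of_ne_unlock hatomic ht e (by simp) (hσ.trans hstep) fun g' hg' => ?_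
    rw [hg g' (.inl hg'), hlv]

theorem covers_lock (hatomic : P.AtomicAccess) (hunlock : ProperUnlocking P)
    (hprot : Protects P B.prot) (hη : IsAbstractSolution D B P η) {p q : L.N} {a : L.M}
    {t₀ t₁ t' : Trace L} (e : P.edge p (.lock a) q) (hc₀ : Collects P (.point p) t₀)
    (hc₁ : Collects P (.mutex a) t₁) (h : t' ∈ semLock P p a q t₀ t₁)
    (ih₀ : Covers P D B η (.point p) t₀) (ih₁ : Covers P D B η (.mutex a) t₁) :
    Covers P D B η (.point q) t' := by
  have hd := (Collects.lock e hc₀ hc₁ h).disciplined hunlock hprot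
  have ht₀ := hc₀.isLocal
  obtain ⟨rfl, σ', rfl, ht'⟩ := h
  set n : Node L := ⟨t₀.sink.idx + 1, q, σ'⟩ with hn
  set t' := ((t₀.union t₁).extend (.lock a) n).addLock a t₁.sink n with ht'def
  have hsub₀ : t₀.Sub t' := Trace.sub_addLock_left ..
  have hsub₁ : t₁.Sub t' := Trace.sub_addLock_right ..
  set S := t₀.lockset t₀.sink with hS
  set r := η (.point t₀.sink.pt S) with hr
  have ih₀ : CoversPoint D B S r t₀ := ih₀
  have hnewEdge : (t₀.sink, .lock a, t'.sink) ∈ t'.edges := .inl rfl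
  have hstep : σ' = t₀.sink.σ := (ht'.edge_step _ _ _ hnewEdge).2.2.2.2.2
  have hlock : t'.lockset t'.sink = insert a S := by
    rw [hS, ← hsub₀.lockset_eq ht₀ ht' ht₀.sink_mem]
    exact ht'.lockset_of_edge hnewEdge
  have hle := hη.edge_le e (D.ne_bot (ih₀.store_mem (L.zero _)))
  show CoversPoint D B _ _ _
  rw [hlock]
  intro σ hσ hg
  change σ.locals = σ' at hσ
  refine D.γ_mono hle (D.γ_inf _ _ ⟨?_, D.mem_γ_biInf _ _ fun Q hQ => ih₁.2 Q hQ σ fun g hgQ => ?_⟩)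
  · refine ih₀.mem_of_ne_unlock hatomic ht₀ e (by simp) (hσ.trans hstep) ?_
    rintro g ⟨b, hb, hbg⟩
    rw [hg g (.inl ⟨b, .inr hb, hbg⟩)]
    exact Trace.lastValue_eq_of_lockset ht₀ ht' hd hsub₀ hnewEdge (by simp) (by simp) hb hbg
  · have hag := B.clusters_prot a Q hQ g hgQ
    rw [hg g (.inl ⟨a, .inl rfl, hag⟩)]
    exact Trace.lastValue_eq_of_locks hc₁.isLocal ht' hd hsub₁ (.inr ⟨rfl, rfl, rfl⟩) hag

theorem covers_join (hatomic : P.AtomicAccess) (hunlock : ProperUnlocking P)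
    (hprot : Protects P B.prot) (hη : IsAbstractSolution D B P η) {p q : L.N} {x : L.X L.rty}
    {x' : L.X L.tid} {t₀ t t₁ t' : Trace L} (e : P.edge p (.join x x') q)
    (hc₀ : Collects P (.point p) t₀) (hc : Collects P (.point p) t)
    (hc₁ : Collects P (.thread (t.sink.σ ⟨L.tid, x'⟩)) t₁) (h : t' ∈ semJoin P p x x' q t₀ t₁)
    (ih₀ : Covers P D B η (.point p) t₀)
    (ih₁ : Covers P D B η (.thread (t.sink.σ ⟨L.tid, x'⟩)) t₁) :
    Covers P D B η (.point q) t' := by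
  have hd := (Collects.join e hc₀ hc hc₁ h).disciplined hunlock hprot
  have ht₀ := hc₀.isLocal
  obtain ⟨rfl, σ', rfl, ht'⟩ := h
  set n : Node L := ⟨t₀.sink.idx + 1, q, σ'⟩ with hn
  set t' := ((t₀.union t₁).extend (.join x x') n).addJoin t₁.sink n with ht'def
  have hsub₀ : t₀.Sub t' := Trace.sub_addJoin_left ..
  have hsub₁ : t₁.Sub t' := Trace.sub_addJoin_right ..
  set S := t₀.lockset t₀.sink with hS
  set r := η (.point t₀.sink.pt S) with hr
  have ih₀ : CoversPoint D B S r t₀ := ih₀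
  have hnewEdge : (t₀.sink, .join x x', t'.sink) ∈ t'.edges := .inl rfl
  obtain ⟨c, hstep⟩ := (ht'.edge_step _ _ _ hnewEdge).2.2.2.2.2
  change σ' = _ at hstep
  have hlock : t'.lockset t'.sink = S := by
    rw [hS, ← hsub₀.lockset_eq ht₀ ht' ht₀.sink_mem]
    exact ht'.lockset_of_edge hnewEdge
  have hle := hη.edge_le e (D.ne_bot (ih₀.store_mem (L.zero _)))
  obtain ⟨htid, y, j, ⟨m, hret⟩, hij, hstore⟩ := ih₁
  -- The joined thread is the one whose id is stored in `x'`, and `x` receives its result.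
  obtain ⟨hid, hval⟩ := ht'.join_value _ _ _ _ _ _ _ hnewEdge (hsub₁.edges hret)
    (.inr ⟨rfl, rfl⟩)
  obtain ⟨-, -, -, hmtid, -, hmσ⟩ := hc₁.isLocal.edge_step _ _ _ hret
  change t₁.sink.σ = m.σ at hmσ
  have hc : c = t₁.sink.σ ⟨L.rty, y⟩ := by
    rw [hmσ, ← hval]
    change c = σ' ⟨L.rty, x⟩
    rw [hstep, Function.update_self]
  have hid : t₀.sink.σ ⟨L.tid, x'⟩ ∈ V.γ j := by
    rwa [hid, ← hmtid, htid]
  have hne : (D.unlift r).val ⟨L.tid, .loc x'⟩ ⊓ j ≠ ⊥ :=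
    V.ne_bot (V.γ_inf _ _ ⟨D.γ_unlift _ _ (ih₀.store_mem (L.zero _)) ⟨L.tid, .loc x'⟩, hid⟩)
  have hcmem : c ∈ V.γ (⨆ (i : A L.tid) (_ : (D.unlift r).val ⟨L.tid, .loc x'⟩ ⊓ i ≠ ⊥),
      (D.unlift (η (.thread i))).val (retVar L)) := by
    refine V.γ_mono (le_iSup₂_of_le j hne le_rfl) ?_
    rw [hc]
    exact D.γ_unlift _ _ hstore (retVar L)
  show CoversPoint D B _ _ _
  rw [hlock]
  intro σ hσ hg
  change σ.locals = σ' at hσ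
  refine D.γ_mono hle ?_
  obtain ⟨ρ, hρ, hρg, rfl⟩ := Store.exists_update_eq (hσ.trans hstep)
  refine D.mem_γ_assignAbs (ih₀.mem_of_ne_unlock hatomic ht₀ e (by simp) hρ ?_) hcmem
  rintro g ⟨b, hb, hbg⟩
  rw [hρg, hg g (.inl ⟨b, hb, hbg⟩)]
  exact Trace.lastValue_eq_of_lockset ht₀ ht' hd hsub₀ hnewEdge (by simp) (by simp) hb hbg

theorem covers_unlockSide (hη : IsAbstractSolution D B P η) {p q : L.N} {a : L.M} {t t' : Trace L}
    (e : P.edge p (.unlock a) q) (hc : Collects P (.point p) t)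
    (h : t' ∈ sem₁ P p (.unlock a) q t) (ih : Covers P D B η (.point p) t) :
    Covers P D B η (.mutex a) t' := by
  obtain ⟨rfl, σ', rfl, ht', -⟩ := h
  refine ⟨.inl (t.last_extend _ _), fun Q hQ σ hσ => ?_⟩
  have ih : CoversPoint D B _ _ t := ih
  have hle := hη.edge_side_le e (D.ne_bot (ih.store_mem (L.zero _))) (.cluster a Q)
  simp only [absRhsNonBot, true_and, if_pos hQ] at hle
  refine D.γ_mono hle (D.γ_restr _ _ _ (ih.store_mem (L.zero _)) σ ?_)
  rintro y ⟨g, hg, rfl⟩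
  exact (hσ g hg).trans (Trace.lastValue_extend hc.isLocal ht' (by simp))

theorem covers_createSide (hν : SoundNu D B P) (hη : IsAbstractSolution D B P η) {p q u₁ : L.N}
    {x : L.X L.tid} {t t' : Trace L} (e : P.edge p (.create x u₁) q)
    (hc : Collects P (.point p) t) (h : t' ∈ newTraces P p u₁ t)
    (ih : Covers P D B η (.point p) t) : Covers P D B η (.point u₁) t' := by
  have ih : CoversPoint D B _ _ t := ih
  have hi := hν p u₁ _ _ t ⟨hc.traces, rfl, hc.pt_eq, L.zero _, ih.store_mem _⟩ _ h
  obtain ⟨rfl, i, -, rfl, ht'⟩ := h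
  have hi : i ∈ V.γ (B.ν t.sink.pt u₁ (η (.point t.sink.pt (t.lockset t.sink)))) := by
    simpa [Trace.spawn, Node.tid] using hi
  show CoversPoint D B _ _ _
  rw [Trace.lockset_eq_empty ht' rfl]
  intro σ hσ _
  have hle := hη.edge_side_le e (D.ne_bot (ih.store_mem (L.zero _))) (.point u₁ ∅)
  simp only [absRhsNonBot, Function.update_self] at hle
  refine D.γ_mono hle (D.γ_restr _ _ _ (D.mem_γ_assignAbs (ih.store_mem (L.zero _)) hi) σ ?_)
  rintro y ⟨z, rfl⟩
  have hσ' : σ.locals =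
      Store.locals (Function.update (t.store (L.zero _)) ⟨L.tid, .loc L.self⟩ i) :=
    hσ.trans (Store.locals_update_loc (t.store (L.zero _)) L.self i).symm
  exact congrFun hσ' z

theorem covers_retSide (hη : IsAbstractSolution D B P η) {p q : L.N} {x : L.X L.rty}
    {t t' : Trace L} (e : P.edge p (.ret x) q) (h : t' ∈ sem₁ P p (.ret x) q t)
    (ih : Covers P D B η (.point p) t) : Covers P D B η (.thread t.sink.tid) t' := by
  obtain ⟨rfl, σ', rfl, ht', -⟩ := h
  have ih : CoversPoint D B _ _ t := ih
  have hmem := ih.store_mem (L.zero _)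
  obtain ⟨-, -, -, htid, -, hstep⟩ := ht'.edge_step _ _ _ (.inl rfl)
  change σ' = _ at hstep
  refine ⟨htid, x, _, t.last_extend _ _, D.γ_unlift _ _ hmem (selfVar L), ?_⟩
  have hle := hη.edge_side_le e (D.ne_bot hmem)
    (.thread ((D.unlift (η (.point t.sink.pt (t.lockset t.sink)))).val (selfVar L)))
  simp only [absRhsNonBot, Function.update_self] at hle
  refine D.γ_mono hle (D.γ_restr _ _ _ (D.γ_assign _ _ _ _ hmem) _ ?_)
  rintro y rfl
  rw [retVar, Function.update_self]
  exact congrFun hstep _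

theorem Collects.covers (hatomic : P.AtomicAccess) (hunlock : ProperUnlocking P)
    (hprot : Protects P B.prot) (hmain : L.zero L.tid ∈ V.γ B.i₀) (hν : SoundNu D B P)
    (hη : IsAbstractSolution D B P η) {k : CUnknown L} {t : Trace L} (h : Collects P k t) :
    Covers P D B η k t := by
  induction h with
  | init ht => exact covers_init hmain hη ht
  | initMutex a ht => exact covers_initMutex hη a ht
  | unary e hl hj hc h ih => exact covers_unary hatomic hν hη e hl hj hc h ih
  | lock e hc₀ hc₁ h ih₀ ih₁ => exact covers_lock hatomic hunlock hprot hη e hc₀ hc₁ h ih₀ ih₁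
  | join e hc₀ hc hc₁ h ih₀ _ ih₁ =>
    exact covers_join hatomic hunlock hprot hη e hc₀ hc hc₁ h ih₀ ih₁
  | unlockSide e hc h ih => exact covers_unlockSide hη e hc h ih
  | createSide e hc h ih => exact covers_createSide hν hη e hc h ih
  | retSide e _ h ih => exact covers_retSide hη e h ih

end Soundness

end LocalTraces

theorem mainTheorem3 {L : Lang.{u}} (P : Prog L)
    {A : L.Ty → Type v} [∀ τ, CompleteLattice (A τ)] (V : ValueDomain L A)
    {R : Type w} [CompleteLattice R] (D : RelationalDomain L A V R) (B : Params L A R)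
    (hatomic : P.AtomicAccess) (hunlock : ProperUnlocking P) (hprot : Protects P B.prot)
    (hmain : L.zero L.tid ∈ V.γ B.i₀) (hν : SoundNu D B P)
    (η : AUnknown L A → R) (hη : IsAbstractSolution D B P η) :
    IsSound D B P η := by
  have covers : ∀ {k : CUnknown L} {t : Trace L}, t ∈ collecting P k →
      Collects P k t ∧ Covers P D B η k t := fun h =>
    have h := mem_collecting_iff.1 h
    ⟨h, h.covers hatomic hunlock hprot hmain hν hη⟩
  refine ⟨?_, fun i t h => ?_, fun a Q hQ t h => ?_⟩
  · rintro p _ t ⟨h, rfl⟩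
    obtain ⟨hc, hcov⟩ := covers h
    exact ⟨hc.traces, rfl, hc.pt_eq, L.zero _, CoversPoint.store_mem hcov _⟩
  · obtain ⟨hc, -, x, j, hlast, hij, hmem⟩ := covers h
    simp only [Set.mem_iUnion]
    exact ⟨j, hij, hc.traces, x, hlast, hmem⟩
  · obtain ⟨hc, hlast, hcov⟩ := covers h
    exact ⟨hc.traces, hlast, L.zero _, hcov Q hQ _ fun _ _ => rfl⟩
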